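/- For $N\in\mathbb{N}$ put $\alpha_N=\frac{3N-14-4\sqrt6}{4+2\sqrt6}$. Let $N\ge 1$ and $\alpha\in\mathbb{R}$. By a solution we mean a function $U\in C^2(\mathbb{R}^N)$ such that $\Delta U(y)=\frac{|y|^\alpha}{U(y)^2}$ for all $y\in\mathbb{R}^N$ and $U\ge C$ on $\mathbb{R}^N$ for some constant $C>0$ (depending on $U$). For such $U$ set $$\mu_1(U)=\inf\left\{\int_{\mathbb{R}^N}\Big(|\nabla\phi|^2-\frac{2|y|^\alpha}{U^3}\phi^2\Big)\,dy\ :\ \phi\in C_0^\infty(\mathbb{R}^N),\ \int_{\mathbb{R}^N}\phi^2\,dy=1\right\}\in[-\infty,\infty).$$ 1. If either $1\le N\le 7$ and $\alpha\ge 0$, or $N\ge 8$ and $\alpha>\alpha_N$, then every solution $U$ is linearly unstable, that is, $\mu_1(U)<0$. 2. If $N\ge 8$ and $0\le\alpha\le\alpha_N$, then there exists at least one solution $U$ with $\mu_1(U)\ge 0$. -/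

import Mathlib

open MeasureTheory
open scoped ContDiff

/-- The critical exponent `α_N = (3N - 14 - 4√6) / (4 + 2√6)`. -/
noncomputable def alphaCrit (N : ℕ) : ℝ :=
  (3 * (N : ℝ) - 14 - 4 * Real.sqrt 6) / (4 + 2 * Real.sqrt 6)

/-- `U` is a classical solution of `ΔU = |y|^α / U²` on all of `ℝ^N` that is bounded below by
a positive constant. (`Real.rpow` satisfies `0 ^ 0 = 1`, so for `α = 0` the weight is `1`.) -/
structure IsEntireSolution (N : ℕ) (α : ℝ) (U : EuclideanSpace ℝ (Fin N) → ℝ) : Prop where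
  contDiff : ContDiff ℝ 2 U
  equation : ∀ y, Laplacian.laplacian U y = ‖y‖ ^ α / U y ^ 2
  lower_bound : ∃ C : ℝ, 0 < C ∧ ∀ y, C ≤ U y

/-- The admissible test functions: `φ ∈ C_0^∞(ℝ^N)` (smooth with compact support) with
`∫ φ² = 1`. -/
structure IsNormalizedTest (N : ℕ) (φ : EuclideanSpace ℝ (Fin N) → ℝ) : Prop where
  contDiff : ContDiff ℝ ∞ φ
  compactSupport : HasCompactSupport φ
  normalized : ∫ y, φ y ^ 2 = 1

/-- The quadratic form `∫ (|∇φ|² - (2 |y|^α / U³) φ²)` of the linearized operator at `U`. -/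
noncomputable def stabilityForm (N : ℕ) (α : ℝ) (U φ : EuclideanSpace ℝ (Fin N) → ℝ) : ℝ :=
  ∫ y, (‖gradient φ y‖ ^ 2 - 2 * ‖y‖ ^ α / U y ^ 3 * φ y ^ 2)

/-- The first eigenvalue `μ₁(U)`: the infimum of the quadratic form over normalized test functions.
It is taken in the extended reals, so that it is `-∞` if the form is unbounded below. -/
noncomputable def mu1 (N : ℕ) (α : ℝ) (U : EuclideanSpace ℝ (Fin N) → ℝ) : EReal :=
  sInf {m : EReal | ∃ φ : EuclideanSpace ℝ (Fin N) → ℝ,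
    IsNormalizedTest N φ ∧ m = (stabilityForm N α U φ : EReal)}

/-! Instability. Suppose the quadratic form is nonnegative. Testing it with `U^{-q} φ` and the
equation with `U^{-2q-1} φ²`, then adding a multiple of the second identity to the first, eliminates
`∇U` as soon as `q² < 2(2q+1)`, that is, for `0 < q < 2 + √6`. What remains
(`IsEntireSolution.weighted_estimate`) bounds `∫ |y|^α U^{-2q-3} φ²` by a multiple of `∫ U^{-2q}
|∇φ|²`. For `φ` a high power of a cutoff at scale `R`, Young's inequality absorbs the right side up
to `O(R^{N-s})` with `s = (4q+6)/3 + 2qα/3` (`cutoff_le_geom_mean`). At `q = 2 + √6` the condition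
`s > N` reads `α > α_N`, so a slightly smaller `q` still works (`exists_test_exponent`). Letting `R
→ ∞` then contradicts the positivity of a fixed integral.

Semistability. Put `γ = (2+α)/3` and `κ = γ(γ+N-2)`. The singular solution `c r^γ`, with `c³ κ = 1`,
linearizes to the Hardy-type potential `2κ/r²`, and `α ≤ α_N` means `2κ ≤ ((N-2)/2)²`. The same
inequality prevents the regular radial solution from crossing the singular one
(`singular_le_radial`). Its potential `2 r^α / U³` is therefore at most `2κ/r²`, and Hardy's
inequality (`form_nonneg_of_le_hardy`) concludes. -/

/-! ### Integration by parts and passage from smooth to `C¹` test functions. -/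

/-- The divergence of a vector field on Euclidean space. -/
noncomputable def divergence {N : ℕ} (G : EuclideanSpace ℝ (Fin N) → EuclideanSpace ℝ (Fin N))
    (x : EuclideanSpace ℝ (Fin N)) : ℝ :=
  ∑ i, fderiv ℝ G x (EuclideanSpace.single i 1) i

/-- Integration by parts in each coordinate; compact support of `φ` removes the boundary terms. It
is used with all weights put into `φ`, and `G` equal to `∇U` or to the identity field. -/
theorem integral_fderiv_add_mul_divergence {N : ℕ} {φ : EuclideanSpace ℝ (Fin N) → ℝ}
    {G : EuclideanSpace ℝ (Fin N) → EuclideanSpace ℝ (Fin N)} (hφ : ContDiff ℝ 1 φ)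
    (hs : HasCompactSupport φ) (hG : ContDiff ℝ 1 G) :
    ∫ x, (fderiv ℝ φ x (G x) + φ x * divergence G x) = 0 := by
  have hφ' := hφ.continuous_fderiv one_ne_zero
  have hG' := hG.continuous_fderiv one_ne_zero
  have hφc := hφ.continuous
  have hGc := hG.continuous
  have hs' : HasCompactSupport (fderiv ℝ φ) := hs.fderiv ℝ
  have hGi : ∀ i, ContDiff ℝ 1 (fun x => G x i) := fun i => by fun_prop
  have hGd : ∀ i x v, fderiv ℝ (fun x => G x i) x v = fderiv ℝ G x v i := fun i x v => by
    have h := ((EuclideanSpace.proj (𝕜 := ℝ) i).hasFDerivAt.comp x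
      (hG.differentiable one_ne_zero x).hasFDerivAt).fderiv
    have h2 : (fun x => G x i) = (EuclideanSpace.proj (𝕜 := ℝ) i) ∘ G := rfl
    rw [h2, h]; rfl
  have i1 : ∀ i, Integrable (fun x => fderiv ℝ φ x (EuclideanSpace.single i 1) * G x i) :=
    fun i => Continuous.integrable_of_hasCompactSupport (by fun_prop)
      (hs'.mono fun x hx => by
        simp only [Function.mem_support] at hx ⊢
        contrapose! hx; simp [hx])
  have i2 : ∀ i, Integrable (fun x => φ x * fderiv ℝ G x (EuclideanSpace.single i 1) i) :=
    fun i => Continuous.integrable_of_hasCompactSupport (by fun_prop) hs.mul_right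
  have i3 : ∀ i, Integrable (fun x => φ x * G x i) :=
    fun i => Continuous.integrable_of_hasCompactSupport (by fun_prop) hs.mul_right
  have key : ∀ i, ∫ x, (fderiv ℝ φ x (EuclideanSpace.single i 1) * G x i
      + φ x * fderiv ℝ G x (EuclideanSpace.single i 1) i) = 0 := fun i => by
    rw [integral_add (i1 i) (i2 i)]
    have := integral_mul_fderiv_eq_neg_fderiv_mul_of_integrable (μ := volume)
      (f := φ) (g := fun x => G x i) (v := EuclideanSpace.single i (1:ℝ)) (i1 i)
      (by simpa only [hGd] using i2 i) (i3 i) (fun x _ => hφ.differentiable one_ne_zero x)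
      (fun x _ => (hGi i).differentiable one_ne_zero x)
    simp only [hGd] at this
    rw [this]; ring
  have hsum : ∀ x, fderiv ℝ φ x (G x) + φ x * divergence G x =
      ∑ i, (fderiv ℝ φ x (EuclideanSpace.single i 1) * G x i
      + φ x * fderiv ℝ G x (EuclideanSpace.single i 1) i) := fun x => by
    rw [Finset.sum_add_distrib, divergence, Finset.mul_sum]
    congr 1
    conv_lhs => rw [← (EuclideanSpace.basisFun (Fin N) ℝ).sum_repr (G x)]
    simp [mul_comm]
  simp_rw [hsum]
  refine (integral_finsetSum _ fun i _ => ?_).trans ?_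
  · exact (i1 i).add (i2 i)
  exact Finset.sum_eq_zero fun i _ => key i

lemma contDiff_gradient {N : ℕ} {U : EuclideanSpace ℝ (Fin N) → ℝ} (hU : ContDiff ℝ 2 U) :
    ContDiff ℝ 1 (gradient U) := by
  have : ContDiff ℝ 1 (fderiv ℝ U) := hU.fderiv_right (by norm_num)
  exact (InnerProductSpace.toDual ℝ (EuclideanSpace ℝ (Fin N))).symm.contDiff.comp this

lemma norm_gradient {N : ℕ} (U : EuclideanSpace ℝ (Fin N) → ℝ) (x : EuclideanSpace ℝ (Fin N)) :
    ‖gradient U x‖ = ‖fderiv ℝ U x‖ := by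
  simp [gradient]

theorem laplacian_eq_divergence_gradient {N : ℕ} {U : EuclideanSpace ℝ (Fin N) → ℝ}
    (hU : ContDiff ℝ 2 U) (x : EuclideanSpace ℝ (Fin N)) :
    Laplacian.laplacian U x = divergence (gradient U) x := by
  have h1 : ContDiff ℝ 1 (fderiv ℝ U) := hU.fderiv_right (by norm_num)
  rw [InnerProductSpace.laplacian_eq_iteratedFDeriv_orthonormalBasis U
    (EuclideanSpace.basisFun (Fin N) ℝ)]
  simp only [iteratedFDeriv_two_apply, divergence]
  refine Finset.sum_congr rfl fun i _ => ?_
  have h2 : HasFDerivAt (gradient U) _ x :=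
    ((InnerProductSpace.toDual ℝ (EuclideanSpace ℝ (Fin N))).symm.toContinuousLinearEquiv
      |>.hasFDerivAt).comp x (h1.differentiable one_ne_zero x).hasFDerivAt
  rw [h2.fderiv]
  have h3 : ∀ L : StrongDual ℝ (EuclideanSpace ℝ (Fin N)),
      ((InnerProductSpace.toDual ℝ (EuclideanSpace ℝ (Fin N))).symm L) i =
        L (EuclideanSpace.single i 1) := fun L => by
    have := InnerProductSpace.toDual_symm_apply (𝕜 := ℝ)
      (x := EuclideanSpace.single i (1 : ℝ)) (y := L)
    rw [EuclideanSpace.inner_single_right] at this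
    simpa using this
  simpa using (h3 _).symm

/-- Nonnegativity of a quadratic form `∫ |∇φ|² - Vφ²` passes from smooth to `C¹` test functions. -/
theorem form_nonneg_of_contDiff_one {N : ℕ} {V : EuclideanSpace ℝ (Fin N) → ℝ} (hV : Continuous V)
    (h : ∀ φ : EuclideanSpace ℝ (Fin N) → ℝ, ContDiff ℝ ∞ φ → HasCompactSupport φ →
      0 ≤ ∫ x, (‖fderiv ℝ φ x‖ ^ 2 - V x * φ x ^ 2))
    {φ : EuclideanSpace ℝ (Fin N) → ℝ} (hφ : ContDiff ℝ 1 φ) (hs : HasCompactSupport φ) :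
    0 ≤ ∫ x, (‖fderiv ℝ φ x‖ ^ 2 - V x * φ x ^ 2) := by
  let E := EuclideanSpace ℝ (Fin N)
  have hφ' := hφ.continuous_fderiv one_ne_zero
  have hs' : HasCompactSupport (fderiv ℝ φ) := hs.fderiv ℝ
  -- Mollifiers with outer radius `1/(n+1) ≤ 1`, so every mollification of `φ` is supported in the
  -- closed `1`-neighbourhood `K` of the support of `φ`.
  let ρ : ℕ → ContDiffBump (0 : E) := fun n =>
    ⟨1 / (2 * ((n : ℝ) + 1)), 1 / ((n : ℝ) + 1), by positivity, by
      apply one_div_lt_one_div_of_lt (by positivity); linarith [(n.cast_nonneg : (0:ℝ) ≤ n)]⟩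
  have hρ : Filter.Tendsto (fun n => (ρ n).rOut) Filter.atTop (nhds 0) :=
    tendsto_one_div_add_atTop_nhds_zero_nat
  have hρ1 : ∀ n, (ρ n).rOut ≤ 1 := fun n => by
    change 1 / ((n : ℝ) + 1) ≤ 1
    rw [div_le_one (by positivity)]; linarith [(n.cast_nonneg : (0:ℝ) ≤ n)]
  let ψ : ℕ → E → ℝ := fun n =>
    convolution ((ρ n).normed volume) φ (ContinuousLinearMap.lsmul ℝ ℝ) volume
  let ψ' : ℕ → E → (E →L[ℝ] ℝ) := fun n =>
    convolution ((ρ n).normed volume) (fderiv ℝ φ) (ContinuousLinearMap.lsmul ℝ ℝ) volume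
  have hψ : ∀ n, ContDiff ℝ ∞ (ψ n) := fun n =>
    (ρ n).hasCompactSupport_normed.contDiff_convolution_left _ (ρ n).contDiff_normed
      hφ.continuous.locallyIntegrable
  have hd : ∀ n x, fderiv ℝ (ψ n) x = ψ' n x := fun n x =>
    (hs.hasFDerivAt_convolution_right (ContinuousLinearMap.lsmul ℝ ℝ)
      ((ρ n).continuous_normed.locallyIntegrable) hφ x).fderiv
  set K := Metric.cthickening 1 (tsupport φ) with hK
  have hKc : IsCompact K := hs.isCompact.cthickening
  have hKball : ∀ n x, x ∉ K → ∀ y ∈ Metric.ball x (ρ n).rOut, y ∉ tsupport φ := by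
    intro n x hx y hy hy'
    apply hx
    apply Metric.mem_cthickening_of_dist_le x y 1 _ hy'
    rw [Metric.mem_ball, dist_comm] at hy
    exact hy.le.trans (hρ1 n)
  have hz : ∀ x, x ∉ tsupport φ → φ x = 0 := fun x hx => image_eq_zero_of_notMem_tsupport hx
  have hz' : ∀ x, x ∉ tsupport φ → fderiv ℝ φ x = 0 := fun x hx =>
    image_eq_zero_of_notMem_tsupport fun h => hx (tsupport_fderiv_subset ℝ h)
  have hout : ∀ n x, x ∉ K → ψ n x = 0 ∧ ψ' n x = 0 := fun n x hx => by
    have hb := hKball n x hx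
    have hx0 := hb x (Metric.mem_ball_self (ρ n).rOut_pos)
    constructor
    · rw [← hz x hx0]
      exact (ρ n).normed_convolution_eq_right fun y hy => by rw [hz y (hb y hy), hz x hx0]
    · rw [← hz' x hx0]
      exact (ρ n).normed_convolution_eq_right fun y hy => by rw [hz' y (hb y hy), hz' x hx0]
  have hψs : ∀ n, HasCompactSupport (ψ n) := fun n =>
    HasCompactSupport.intro hKc fun x hx => (hout n x hx).1
  obtain ⟨M, hM⟩ := hs.exists_bound_of_continuous hφ.continuous
  obtain ⟨M', hM'⟩ := hs'.exists_bound_of_continuous hφ'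
  obtain ⟨C, hC⟩ := hKc.exists_bound_of_continuousOn hV.continuousOn
  have hM0 : 0 ≤ M := (norm_nonneg _).trans (hM 0)
  have hM0' : 0 ≤ M' := (norm_nonneg _).trans (hM' 0)
  -- The mollification differs from `φ` by at most the oscillation `2M`, so `3M` bounds it uniformly
  -- in `n`; a crude bound suffices for dominated convergence.
  have hb : ∀ n x, ‖ψ n x‖ ≤ 3 * M := fun n x => by
    have h1 := (ρ n).dist_normed_convolution_le (μ := volume) (x₀ := x) (ε := 2 * M)
      hφ.continuous.aestronglyMeasurable fun y _ => by
        rw [dist_eq_norm]; linarith [norm_sub_le (φ y) (φ x), hM x, hM y]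
    rw [dist_eq_norm] at h1
    have h2 := norm_le_insert' (ψ n x) (φ x)
    linarith [hM x, h1, h2]
  have hb' : ∀ n x, ‖ψ' n x‖ ≤ 3 * M' := fun n x => by
    have h1 := (ρ n).dist_normed_convolution_le (μ := volume) (x₀ := x) (ε := 2 * M')
      hφ'.aestronglyMeasurable fun y _ => by
        rw [dist_eq_norm]; linarith [norm_sub_le (fderiv ℝ φ y) (fderiv ℝ φ x), hM' x, hM' y]
    rw [dist_eq_norm] at h1
    have h2 := norm_le_insert' (ψ' n x) (fderiv ℝ φ x)
    linarith [hM' x, h1, h2]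
  have hlim : Filter.Tendsto (fun n => ∫ x, (‖fderiv ℝ (ψ n) x‖ ^ 2 - V x * ψ n x ^ 2))
      Filter.atTop (nhds (∫ x, (‖fderiv ℝ φ x‖ ^ 2 - V x * φ x ^ 2))) := by
    refine tendsto_integral_of_dominated_convergence
      (K.indicator fun _ => (3 * M') ^ 2 + C * (3 * M) ^ 2) ?_ ?_ ?_ ?_
    · intro n
      have h1 := (hψ n).continuous_fderiv (by simp)
      have h2 := (hψ n).continuous
      exact Continuous.aestronglyMeasurable (by fun_prop)
    · exact (integrable_indicator_iff hKc.measurableSet).2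
        (integrableOn_const hKc.measure_lt_top.ne)
    · intro n
      refine Filter.Eventually.of_forall fun x => ?_
      by_cases hx : x ∈ K
      · rw [Set.indicator_of_mem hx, hd]
        refine (norm_sub_le _ _).trans (add_le_add ?_ ?_)
        · rw [norm_pow, norm_norm]; gcongr; exact hb' n x
        · rw [norm_mul, norm_pow]
          have := hC x hx
          have h0 := (norm_nonneg _).trans this
          gcongr; exact hb n x
      · rw [Set.indicator_of_notMem hx, hd, (hout n x hx).1, (hout n x hx).2]; simp
    · refine Filter.Eventually.of_forall fun x => ?_
      simp_rw [hd]
      have h1 : Filter.Tendsto (fun n => ψ n x) Filter.atTop (nhds (φ x)) :=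
        ContDiffBump.convolution_tendsto_right_of_continuous hρ hφ.continuous x
      have h2 : Filter.Tendsto (fun n => ψ' n x) Filter.atTop (nhds (fderiv ℝ φ x)) :=
        ContDiffBump.convolution_tendsto_right_of_continuous hρ hφ' x
      exact (h2.norm.pow 2).sub ((h1.pow 2).const_mul _)
  exact ge_of_tendsto' hlim fun n => h (ψ n) (hψ n) (hψs n)

/-! ### Integral estimates for stable solutions. -/

lemma continuous_norm_rpow {N : ℕ} {α : ℝ} (hα : 0 ≤ α) :
    Continuous fun x : EuclideanSpace ℝ (Fin N) => ‖x‖ ^ α :=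
  continuous_norm.rpow_const fun _ => Or.inr hα

lemma IsEntireSolution.pos {N : ℕ} {α : ℝ} {U : EuclideanSpace ℝ (Fin N) → ℝ}
    (h : IsEntireSolution N α U) (x : EuclideanSpace ℝ (Fin N)) : 0 < U x := by
  obtain ⟨C, hC, hU⟩ := h.lower_bound
  exact hC.trans_le (hU x)

/-- If `μ₁(U) ≥ 0`, the quadratic form is nonnegative on all smooth compactly supported functions,
normalized or not. -/
lemma form_nonneg_of_mu1_nonneg {N : ℕ} {α : ℝ} {U : EuclideanSpace ℝ (Fin N) → ℝ}
    (hμ : 0 ≤ mu1 N α U) {φ : EuclideanSpace ℝ (Fin N) → ℝ} (hφ : ContDiff ℝ ∞ φ)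
    (hs : HasCompactSupport φ) :
    0 ≤ ∫ x, (‖fderiv ℝ φ x‖ ^ 2 - 2 * ‖x‖ ^ α / U x ^ 3 * φ x ^ 2) := by
  have hc := hφ.continuous
  have hn : 0 ≤ ∫ x, φ x ^ 2 := integral_nonneg fun x => sq_nonneg _
  rcases hn.eq_or_lt with h0 | h0
  · have hφ0 : φ = 0 := by
      by_contra hne
      have : 0 < ∫ x, φ x ^ 2 := by
        obtain ⟨x, hx⟩ := Function.ne_iff.1 hne
        refine Continuous.integral_pos_of_hasCompactSupport_nonneg_nonzero (x := x)
          (by fun_prop) ?_ (fun x => sq_nonneg _) (pow_ne_zero 2 hx)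
        exact hs.comp_left (g := fun t : ℝ => t ^ 2) (by simp)
      exact this.ne h0
    subst hφ0
    simp
  · set I := ∫ x, φ x ^ 2
    set c := (Real.sqrt I)⁻¹ with hcdef
    have hI : 0 < Real.sqrt I := Real.sqrt_pos.2 h0
    have hc2 : c ^ 2 * I = 1 := by
      rw [hcdef, inv_pow, Real.sq_sqrt h0.le, inv_mul_cancel₀ h0.ne']
    have hcpos : 0 < c ^ 2 := by positivity
    have ht : IsNormalizedTest N (fun x => c * φ x) :=
      ⟨contDiff_const.mul hφ, hs.mul_left, by simp_rw [mul_pow]; rw [integral_const_mul, hc2]⟩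
    have h1 : (0 : EReal) ≤ (stabilityForm N α U (fun x => c * φ x) : EReal) :=
      hμ.trans (sInf_le ⟨_, ht, rfl⟩)
    have h2 : 0 ≤ stabilityForm N α U (fun x => c * φ x) := by exact_mod_cast h1
    have h3 : stabilityForm N α U (fun x => c * φ x) =
        c ^ 2 * ∫ x, (‖fderiv ℝ φ x‖ ^ 2 - 2 * ‖x‖ ^ α / U x ^ 3 * φ x ^ 2) := by
      rw [stabilityForm, ← integral_const_mul]
      congr 1
      ext x
      have hd : DifferentiableAt ℝ φ x := hφ.differentiable (by simp) x
      rw [norm_gradient, fderiv_const_mul hd, norm_smul, mul_pow, Real.norm_eq_abs, sq_abs]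
      ring
    rw [h3] at h2
    exact nonneg_of_mul_nonneg_right h2 hcpos

lemma inner_gradient {N : ℕ} (f : EuclideanSpace ℝ (Fin N) → ℝ) (x v : EuclideanSpace ℝ (Fin N)) :
    inner ℝ (gradient f x) v = fderiv ℝ f x v := by
  simp [gradient]

/-- The Caccioppoli-type estimate for stable solutions, from testing stability with `U^{-q} φ` and
the equation with `U^{-2q-1} φ²`. -/
theorem IsEntireSolution.weighted_estimate {N : ℕ} {α : ℝ} (hα : 0 ≤ α)
    {U : EuclideanSpace ℝ (Fin N) → ℝ} (hU : IsEntireSolution N α U)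
    (hst : ∀ φ : EuclideanSpace ℝ (Fin N) → ℝ, ContDiff ℝ 1 φ → HasCompactSupport φ →
      0 ≤ ∫ x, (‖fderiv ℝ φ x‖ ^ 2 - 2 * ‖x‖ ^ α / U x ^ 3 * φ x ^ 2))
    {q : ℝ} (hq : 0 < q) (hq2 : q ^ 2 < 2 * (2 * q + 1)) :
    ∃ K δ : ℝ, 0 < K ∧ 0 < δ ∧ ∀ φ : EuclideanSpace ℝ (Fin N) → ℝ, ContDiff ℝ 1 φ →
      HasCompactSupport φ → 0 ≤ ∫ x, (U x ^ (-q)) ^ 2 *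
        (K * ‖fderiv ℝ φ x‖ ^ 2 - δ * (‖x‖ ^ α / U x ^ 3 * φ x ^ 2)) := by
  -- `l` is the multiple of the tested equation that is added to the stability inequality. The lower
  -- bound makes the coefficient `-a` of `|∇U|²` negative; `l < 2` keeps `-(2-l)` in front of the
  -- weight.
  obtain ⟨l, hl1, hl2⟩ : ∃ l, q ^ 2 / (2 * q + 1) < l ∧ l < 2 :=
    exists_between (by rw [div_lt_iff₀ (by positivity)]; linarith)
  rw [div_lt_iff₀ (by positivity)] at hl1
  set a := l * (2 * q + 1) - q ^ 2 with ha
  have hapos : 0 < a := by rw [ha]; linarith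
  refine ⟨1 + (l - q) ^ 2 / a, 2 - l, by positivity, by linarith, fun φ hφ hs => ?_⟩
  have hUc := hU.contDiff.continuous
  have hU1 : ContDiff ℝ 1 U := hU.contDiff.of_le (by norm_num)
  have hUd : Differentiable ℝ U := hU1.differentiable one_ne_zero
  have hφd : Differentiable ℝ φ := hφ.differentiable one_ne_zero
  have hpos := hU.pos
  have hne : ∀ x, U x ≠ 0 := fun x => (hpos x).ne'
  have hφc := hφ.continuous
  have hφ' := hφ.continuous_fderiv one_ne_zero
  have hgc := (contDiff_gradient hU.contDiff).continuous
  have hρ := continuous_norm_rpow (N := N) hα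
  have ht : ContDiff ℝ 1 fun x => U x ^ (-q) := hU1.rpow_const_of_ne hne
  have htc := ht.continuous
  have htd : ∀ x, HasFDerivAt (fun x => U x ^ (-q))
      ((-q * (U x ^ (-q) / U x)) • fderiv ℝ U x) x := fun x => by
    have := (hUd x).hasFDerivAt.rpow_const (p := -q) (Or.inl (hne x))
    rwa [Real.rpow_sub_one (hne x)] at this
  -- stability tested with `U^{-q} φ`
  have hd1 : ∀ x, fderiv ℝ (fun x => U x ^ (-q) * φ x) x =
      (U x ^ (-q)) • (fderiv ℝ φ x - (q * φ x / U x) • fderiv ℝ U x) := fun x => by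
    have h0 : fderiv ℝ (fun x => U x ^ (-q) * φ x) x = _ := ((htd x).mul (hφd x).hasFDerivAt).fderiv
    rw [h0, smul_sub, smul_smul, smul_smul, sub_eq_add_neg,
      ← neg_smul]
    congr 2
    ring
  have hn1 : ∀ x, ‖fderiv ℝ (fun x => U x ^ (-q) * φ x) x‖ ^ 2 = (U x ^ (-q)) ^ 2 *
      (‖fderiv ℝ φ x‖ ^ 2 - 2 * (q * φ x / U x) * fderiv ℝ φ x (gradient U x)
        + (q * φ x / U x) ^ 2 * ‖gradient U x‖ ^ 2) := fun x => by
    have hg : gradient (fun x => U x ^ (-q) * φ x) x =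
        (U x ^ (-q)) • (gradient φ x - (q * φ x / U x) • gradient U x) := by
      simp only [gradient, hd1, map_smulₛₗ, map_sub]; simp
    rw [← norm_gradient, hg, norm_smul, mul_pow, norm_sub_sq_real, norm_smul, inner_smul_right,
      inner_gradient, norm_gradient φ]
    simp only [Real.norm_eq_abs, mul_pow, sq_abs]
    ring
  have h1 := hst _ (ht.mul hφ) hs.mul_left
  simp only [hn1] at h1
  -- the equation tested with `U^{-2q-1} φ²`
  set η : EuclideanSpace ℝ (Fin N) → ℝ := fun x => (U x ^ (-q)) ^ 2 * (U x)⁻¹ * φ x ^ 2 with hη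
  have hη1 : ContDiff ℝ 1 η := ((ht.pow 2).mul (hU1.inv hne)).mul (hφ.pow 2)
  have hs2 : HasCompactSupport fun x => φ x ^ 2 := hs.comp_left (g := fun t : ℝ => t ^ 2) (by simp)
  have h2 := integral_fderiv_add_mul_divergence hη1 hs2.mul_left (contDiff_gradient hU.contDiff)
  have hd2 : ∀ x, fderiv ℝ η x (gradient U x) + η x * divergence (gradient U) x =
      (U x ^ (-q)) ^ 2 * (2 * φ x / U x * fderiv ℝ φ x (gradient U x)
        - (2 * q + 1) * (φ x / U x) ^ 2 * ‖gradient U x‖ ^ 2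
        + ‖x‖ ^ α / U x ^ 3 * φ x ^ 2) := fun x => by
    have h3 := (((htd x).pow 2).mul ((hasDerivAt_inv (hne x)).comp_hasFDerivAt x
      (hUd x).hasFDerivAt)).mul ((hφd x).hasFDerivAt.pow 2)
    have h4 : fderiv ℝ U x (gradient U x) = ‖gradient U x‖ ^ 2 := by
      rw [← inner_gradient, real_inner_self_eq_norm_sq]
    rw [← laplacian_eq_divergence_gradient hU.contDiff, hU.equation]
    have h5 : fderiv ℝ η x = _ := h3.fderiv
    rw [h5]
    have := hne x
    simp only [_root_.add_apply, _root_.smul_apply, h4, smul_eq_mul, hη,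
      nsmul_eq_mul, Function.comp, Pi.mul_apply]
    field_simp
    push_cast
    ring
  simp only [hd2] at h2
  have hs' : HasCompactSupport (fderiv ℝ φ) := hs.fderiv ℝ
  have hsz : ∀ x, x ∉ tsupport φ → φ x = 0 ∧ fderiv ℝ φ x = 0 := fun x hx =>
    ⟨image_eq_zero_of_notMem_tsupport hx,
      image_eq_zero_of_notMem_tsupport fun h => hx (tsupport_fderiv_subset ℝ h)⟩
  have i1 : Integrable fun x => ((U x ^ (-q)) ^ 2 *
      (‖fderiv ℝ φ x‖ ^ 2 - 2 * (q * φ x / U x) * fderiv ℝ φ x (gradient U x)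
        + (q * φ x / U x) ^ 2 * ‖gradient U x‖ ^ 2)
        - 2 * ‖x‖ ^ α / U x ^ 3 * (U x ^ (-q) * φ x) ^ 2) := by
    refine Continuous.integrable_of_hasCompactSupport (by fun_prop (disch := simp [hne]))
      (HasCompactSupport.intro hs fun x hx => ?_)
    simp [hsz x hx]
  have i2 : Integrable fun x => ((U x ^ (-q)) ^ 2 *
      (2 * φ x / U x * fderiv ℝ φ x (gradient U x)
        - (2 * q + 1) * (φ x / U x) ^ 2 * ‖gradient U x‖ ^ 2
        + ‖x‖ ^ α / U x ^ 3 * φ x ^ 2)) := by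
    refine Continuous.integrable_of_hasCompactSupport (by fun_prop (disch := simp [hne]))
      (HasCompactSupport.intro hs fun x hx => ?_)
    simp [hsz x hx]
  have i3 : Integrable fun x => (U x ^ (-q)) ^ 2 * ((1 + (l - q) ^ 2 / a) * ‖fderiv ℝ φ x‖ ^ 2
      - (2 - l) * (‖x‖ ^ α / U x ^ 3 * φ x ^ 2)) := by
    refine Continuous.integrable_of_hasCompactSupport (by fun_prop (disch := simp [hne]))
      (HasCompactSupport.intro hs fun x hx => ?_)
    simp [hsz x hx]
  have h6 := integral_add i1 (i2.const_mul l)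
  rw [integral_const_mul, h2, mul_zero, add_zero] at h6
  rw [← h6] at h1
  refine h1.trans (integral_mono (i1.add (i2.const_mul l)) i3 fun x => ?_)
  have hcs : |fderiv ℝ φ x (gradient U x)| ≤ ‖fderiv ℝ φ x‖ * ‖gradient U x‖ := by
    have := (fderiv ℝ φ x).le_opNorm (gradient U x)
    rwa [Real.norm_eq_abs] at this
  -- The cross term has coefficient `2(l-q)`. Completing the square spends exactly the available `a
  -- |∇U|²` and leaves `(l-q)²/a` times `|∇φ|²`, whence the value of `K`.
  have key : 2 * (l - q) * (φ x / U x) * fderiv ℝ φ x (gradient U x) ≤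
      a * (φ x / U x) ^ 2 * ‖gradient U x‖ ^ 2 + (l - q) ^ 2 / a * ‖fderiv ℝ φ x‖ ^ 2 := by
    have e1 : 2 * (l - q) * (φ x / U x) * fderiv ℝ φ x (gradient U x) ≤
        2 * (|l - q| * ‖fderiv ℝ φ x‖) * (|φ x / U x| * ‖gradient U x‖) := by
      refine (le_abs_self _).trans ?_
      rw [abs_mul, abs_mul, abs_mul, abs_two]
      calc _ ≤ 2 * |l - q| * |φ x / U x| * (‖fderiv ℝ φ x‖ * ‖gradient U x‖) := by gcongr
        _ = _ := by ring
    refine e1.trans ?_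
    have e2 : (|l - q| * ‖fderiv ℝ φ x‖) ^ 2 = (l - q) ^ 2 * ‖fderiv ℝ φ x‖ ^ 2 := by
      rw [mul_pow, sq_abs]
    have e3 : (|φ x / U x| * ‖gradient U x‖) ^ 2 = (φ x / U x) ^ 2 * ‖gradient U x‖ ^ 2 := by
      rw [mul_pow, sq_abs]
    rw [mul_assoc a, ← e3, div_mul_eq_mul_div, ← e2]
    set A := |l - q| * ‖fderiv ℝ φ x‖
    set B := |φ x / U x| * ‖gradient U x‖
    have : a * B ^ 2 + A ^ 2 / a - 2 * A * B = (a * B - A) ^ 2 / a := by field_simp; ring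
    have h0 : 0 ≤ (a * B - A) ^ 2 / a := by positivity
    linarith
  have ht2 : 0 ≤ (U x ^ (-q)) ^ 2 := sq_nonneg _
  have := mul_le_mul_of_nonneg_left key ht2
  simp only [ha] at this ⊢
  have e4 : ∀ t p g r : ℝ, (t ^ 2 * (p ^ 2 - 2 * (q * φ x / U x) * r + (q * φ x / U x) ^ 2 * g ^ 2)
      - 2 * ‖x‖ ^ α / U x ^ 3 * (t * φ x) ^ 2) + l * (t ^ 2 * (2 * φ x / U x * r
        - (2 * q + 1) * (φ x / U x) ^ 2 * g ^ 2 + ‖x‖ ^ α / U x ^ 3 * φ x ^ 2)) =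
      t ^ 2 * p ^ 2 + t ^ 2 * (2 * (l - q) * (φ x / U x) * r)
        - t ^ 2 * ((l * (2 * q + 1) - q ^ 2) * (φ x / U x) ^ 2 * g ^ 2)
        - t ^ 2 * ((2 - l) * (‖x‖ ^ α / U x ^ 3 * φ x ^ 2)) := fun t p g r => by ring
  change (_ : ℝ) + l * _ ≤ _
  rw [e4]
  linarith

/-! ### Absorption of the cutoff error and the instability theorem. -/

/-- Young's inequality `K a^θ b^{1-θ} ≤ δ a + C b`. -/
lemma exists_young_bound {θ K δ : ℝ} (hθ0 : 0 < θ) (hθ1 : θ < 1) (hK : 0 ≤ K) (hδ : 0 < δ) :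
    ∃ C : ℝ, 0 ≤ C ∧ ∀ a b : ℝ, 0 ≤ a → 0 ≤ b →
      K * (a ^ θ * b ^ (1 - θ)) ≤ δ * a + C * b := by
  have h1 : 0 < 1 - θ := by linarith
  -- The constant solves `δ^θ C^{1-θ} = K`, which reduces the claim to weighted AM-GM for `δa` and
  -- `Cb`.
  refine ⟨(K / δ ^ θ) ^ (1 / (1 - θ)), by positivity, fun a b ha hb => ?_⟩
  set c := (K / δ ^ θ) ^ (1 / (1 - θ)) with hc
  have hc0 : 0 ≤ c := by positivity
  have hcK : δ ^ θ * c ^ (1 - θ) = K := by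
    have hδθ : δ ^ θ ≠ 0 := (Real.rpow_pos_of_pos hδ θ).ne'
    rw [hc, ← Real.rpow_mul (by positivity), one_div_mul_cancel h1.ne', Real.rpow_one]
    field_simp
  have h2 := Real.geom_mean_le_arith_mean2_weighted hθ0.le h1.le (mul_nonneg hδ.le ha)
    (mul_nonneg hc0 hb) (by ring)
  rw [Real.mul_rpow hδ.le ha, Real.mul_rpow hc0 hb] at h2
  calc K * (a ^ θ * b ^ (1 - θ)) = δ ^ θ * a ^ θ * (c ^ (1 - θ) * b ^ (1 - θ)) := by
        rw [← hcK]; ring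
    _ ≤ _ := h2
    _ ≤ δ * a + c * b := by
        have := mul_nonneg hδ.le ha
        have := mul_nonneg hc0 hb
        exact add_le_add (mul_le_of_le_one_left (by assumption) hθ1.le)
          (mul_le_of_le_one_left (by assumption) (by linarith))

/-- Absorption of the cutoff term: with `A = R^α u^{-(2q+3)} e^{2m}`, the quantity
`R^{-2} u^{-2q} e^{2m-2}` is bounded by `A^θ (R^{-s})^{1-θ}`. -/
lemma cutoff_le_geom_mean {q α R u e : ℝ} {m : ℕ} (hq : 0 < q) (hR : 0 < R)
    (hu : 0 < u) (he0 : 0 ≤ e) (he1 : e ≤ 1) (hm : (2 * q + 3) / 3 ≤ m) :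
    R⁻¹ ^ 2 * (u ^ (-q)) ^ 2 * e ^ (2 * m - 2) ≤
      ((u ^ (-q)) ^ 2 * (R ^ α / u ^ 3 * e ^ (2 * m))) ^ (2 * q / (2 * q + 3)) *
        (R ^ (-((4 * q + 6) / 3 + 2 * q * α / 3))) ^ (1 - 2 * q / (2 * q + 3)) := by
  have h3 : 0 < 2 * q + 3 := by linarith
  have hm0 : (1 : ℝ) < m := lt_of_lt_of_le (by rw [lt_div_iff₀ (by norm_num)]; linarith) hm
  have hm1 : 1 ≤ m := by exact_mod_cast hm0.le
  have hRα := Real.rpow_pos_of_pos hR α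
  have hA : (u ^ (-q)) ^ 2 * (R ^ α / u ^ 3 * e ^ (2 * m)) =
      R ^ α * u ^ (-(2 * q + 3)) * e ^ (2 * m) := by
    have h1 : u ^ (-(2 * q + 3)) = (u ^ (-q)) ^ 2 / u ^ 3 := by
      rw [show -(2 * q + 3) = (-q) * (2 : ℕ) - (3 : ℕ) by push_cast; ring,
        Real.rpow_sub_natCast hu.ne', Real.rpow_mul hu.le, Real.rpow_natCast]
    rw [h1]; ring
  have hup := Real.rpow_pos_of_pos hu (-(2 * q + 3))
  rw [hA, Real.mul_rpow (by positivity) (by positivity), Real.mul_rpow hRα.le hup.le,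
    ← Real.rpow_mul hR.le, ← Real.rpow_mul hu.le, ← Real.rpow_mul hR.le]
  have e1 : u ^ (-(2 * q + 3) * (2 * q / (2 * q + 3))) = (u ^ (-q)) ^ 2 := by
    rw [← Real.rpow_natCast, ← Real.rpow_mul hu.le]
    congr 1; field_simp; push_cast; ring
  have e2 : R ^ (α * (2 * q / (2 * q + 3))) *
      R ^ (-((4 * q + 6) / 3 + 2 * q * α / 3) * (1 - 2 * q / (2 * q + 3))) = R⁻¹ ^ 2 := by
    rw [← Real.rpow_add hR, inv_pow, ← Real.rpow_natCast, ← Real.rpow_neg hR.le]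
    congr 1; field_simp; push_cast; ring
  -- The lower bound on `m` is equivalent to `2mθ ≤ 2m - 2` for `θ = 2q/(2q+3)`; since `e ≤ 1`, the
  -- larger exponent gives the smaller power.
  have e3 : e ^ (2 * m - 2) ≤ (e ^ (2 * m)) ^ (2 * q / (2 * q + 3)) := by
    rcases he0.eq_or_lt with h | h
    · rw [← h, zero_pow (by have : 1 < m := by exact_mod_cast hm0
                            omega)]
      positivity
    · rw [← Real.rpow_natCast, ← Real.rpow_natCast, ← Real.rpow_mul he0]
      refine Real.rpow_le_rpow_of_exponent_ge h he1 ?_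
      rw [Nat.cast_sub (by omega), ← mul_div_assoc, div_le_iff₀ h3]
      push_cast
      rw [div_le_iff₀ (by norm_num)] at hm
      linarith
  calc _ = R⁻¹ ^ 2 * ((u ^ (-q)) ^ 2 * e ^ (2 * m - 2)) := by ring
    _ ≤ R⁻¹ ^ 2 * ((u ^ (-q)) ^ 2 * (e ^ (2 * m)) ^ (2 * q / (2 * q + 3))) := by gcongr
    _ = _ := by rw [← e2, e1]; ring

/-- Both requirements are open: the first is an upper bound `q < 2 + √6`, the second a lower bound
`q > (3N-6)/(4+2α)`. The hypothesis `α > α_N` says that the interval between them is nonempty. -/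
lemma exists_test_exponent {N : ℕ} {α : ℝ} (hα : 0 ≤ α) (hc : alphaCrit N < α) :
    ∃ q : ℝ, 0 < q ∧ q ^ 2 < 2 * (2 * q + 1) ∧
      (N : ℝ) < (4 * q + 6) / 3 + 2 * q * α / 3 := by
  have h6 : 0 < Real.sqrt 6 := by positivity
  have h66 : Real.sqrt 6 ^ 2 = 6 := Real.sq_sqrt (by norm_num)
  have h1 : (3 * (N : ℝ) - 6) / (4 + 2 * α) < 2 + Real.sqrt 6 := by
    rw [div_lt_iff₀ (by positivity)]
    rw [alphaCrit, div_lt_iff₀ (by positivity)] at hc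
    nlinarith
  -- Requiring `q > 2` as well ensures positivity of `q` and of the factor `q - 2 + √6` in `6 -
  -- (q-2)²`.
  obtain ⟨q, hq1, hq2⟩ : ∃ q, max 2 ((3 * (N : ℝ) - 6) / (4 + 2 * α)) < q ∧ q < 2 + Real.sqrt 6 :=
    exists_between (max_lt (by linarith) h1)
  rw [max_lt_iff, div_lt_iff₀ (by positivity)] at hq1
  refine ⟨q, by linarith [hq1.1], ?_, ?_⟩
  · nlinarith [mul_pos (sub_pos.2 hq2) (by linarith : 0 < q - 2 + Real.sqrt 6)]
  · linarith [hq1.2]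

/-- A solution is not semistable when `α > α_N`. -/
theorem IsEntireSolution.mu1_neg {N : ℕ} {α : ℝ} (hN : 1 ≤ N) (hα : 0 ≤ α) (hc : alphaCrit N < α)
    {U : EuclideanSpace ℝ (Fin N) → ℝ} (hU : IsEntireSolution N α U) : mu1 N α U < 0 := by
  by_contra! hμ
  have hUc := hU.contDiff.continuous
  have hpos := hU.pos
  have hne : ∀ x, U x ≠ 0 := fun x => (hpos x).ne'
  have hρ := continuous_norm_rpow (N := N) hα
  obtain ⟨q, hq, hq2, hqN⟩ := exists_test_exponent hα hc
  set s := (4 * q + 6) / 3 + 2 * q * α / 3 with hs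
  obtain ⟨K, δ, hK, hδ, hest⟩ := hU.weighted_estimate hα
    (fun φ h1 h2 => form_nonneg_of_contDiff_one (by fun_prop (disch := simp [hne]))
      (fun φ h1 h2 => form_nonneg_of_mu1_nonneg hμ h1 h2) h1 h2) hq hq2
  have htc : Continuous fun x => U x ^ (-q) := hUc.rpow_const fun x => Or.inl (hne x)
  obtain ⟨m, hm⟩ := exists_nat_ge ((2 * q + 3) / 3)
  let ψ : ContDiffBump (0 : EuclideanSpace ℝ (Fin N)) := ⟨1, 2, one_pos, one_lt_two⟩
  have hψ : ContDiff ℝ 1 ψ := ψ.contDiff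
  obtain ⟨M, hM⟩ := (ψ.hasCompactSupport.fderiv ℝ).exists_bound_of_continuous
    (hψ.continuous_fderiv one_ne_zero)
  have hθ1 : 2 * q / (2 * q + 3) < 1 := by rw [div_lt_one (by positivity)]; linarith
  obtain ⟨C, hC0, hC⟩ := exists_young_bound (θ := 2 * q / (2 * q + 3)) (K := K * (m * M) ^ 2)
    (δ := δ / 2) (by positivity) hθ1 (by positivity) (by positivity)
  -- the integral to be bounded from below
  set g : EuclideanSpace ℝ (Fin N) → ℝ := fun x =>
    δ / 2 * ((U x ^ (-q)) ^ 2 * (‖x‖ ^ α / U x ^ 3)) with hg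
  have hg0 : ∀ x, 0 ≤ g x := fun x => by have := hpos x; positivity
  have hgc : Continuous g := by fun_prop (disch := simp [hne])
  have hψg : 0 < ∫ x, ψ x * g x := by
    -- A unit vector, available because `N ≥ 1`: there the weight `‖y‖^α` is `1` and the bump is
    -- `1`.
    let y : EuclideanSpace ℝ (Fin N) := EuclideanSpace.single ⟨0, hN⟩ 1
    have hy : ‖y‖ = 1 := by simp [y]
    refine Continuous.integral_pos_of_hasCompactSupport_nonneg_nonzero (x := y)
      (ψ.continuous.mul hgc) ψ.hasCompactSupport.mul_right
      (fun x => mul_nonneg ψ.nonneg (hg0 x)) ?_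
    have h1 : ψ y = 1 := ψ.one_of_mem_closedBall (by simp [hy, ψ])
    have := Real.rpow_pos_of_pos (hpos y) (-q)
    have := hpos y
    rw [h1, one_mul, hg]
    simp only [hy, Real.one_rpow]
    positivity
  have hbound : ∀ R : ℝ, 2 ≤ R → ∫ x, ψ x * g x ≤
      (C * 2 ^ N * volume.real (Metric.ball (0 : EuclideanSpace ℝ (Fin N)) 1)) * R ^ (-(s - N)) := by
    intro R hR
    have hR0 : 0 < R := by linarith
    set η : EuclideanSpace ℝ (Fin N) → ℝ := fun x => ψ (R⁻¹ • x) with hη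
    have hη1 : ContDiff ℝ 1 η := hψ.comp (contDiff_const_smul _)
    have hηs : HasCompactSupport η := ψ.hasCompactSupport.comp_smul (inv_ne_zero hR0.ne')
    have hη0 : ∀ x, 0 ≤ η x := fun x => ψ.nonneg
    have hηle : ∀ x, η x ≤ 1 := fun x => ψ.le_one
    have hηout : ∀ x, x ∉ Metric.closedBall (0 : EuclideanSpace ℝ (Fin N)) (2 * R) → η x = 0 :=
      fun x hx => ψ.zero_of_le_dist (by
        rw [Metric.mem_closedBall, not_le, dist_zero_right] at hx
        rw [dist_zero_right, norm_smul, norm_inv, Real.norm_of_nonneg hR0.le]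
        change 2 ≤ R⁻¹ * ‖x‖
        rw [le_inv_mul_iff₀ hR0]; linarith)
    have hηone : ∀ x, ‖x‖ ≤ R → η x = 1 := fun x hx => ψ.one_of_mem_closedBall (by
        rw [mem_closedBall_zero_iff, norm_smul, norm_inv, Real.norm_of_nonneg hR0.le]
        change R⁻¹ * ‖x‖ ≤ 1
        rwa [inv_mul_le_iff₀ hR0, mul_one])
    have hm0 : m ≠ 0 := by
      rintro rfl
      have : 0 < (2 * q + 3) / 3 := by positivity
      simp at hm; linarith
    have hdη : ∀ x, ‖fderiv ℝ η x‖ ≤ R⁻¹ * M := fun x => by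
      have h1 : fderiv ℝ η x = R⁻¹ • fderiv ℝ ψ (R⁻¹ • x) := fderiv_comp_smul R⁻¹
      rw [h1, norm_smul, norm_inv, Real.norm_of_nonneg hR0.le]
      gcongr; exact hM _
    have hd : ∀ x, fderiv ℝ (fun x => η x ^ m) x = (m * η x ^ (m - 1)) • fderiv ℝ η x := fun x => by
      rw [((hη1.differentiable one_ne_zero x).hasFDerivAt.pow m).fderiv]
      simp
    have hφ1 : ContDiff ℝ 1 fun x => η x ^ m := hη1.pow m
    have hφs : HasCompactSupport fun x => η x ^ m :=
      hηs.comp_left (g := fun t : ℝ => t ^ m) (by simp [hm0])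
    have h1 := hest _ hφ1 hφs
    have hball : IsCompact (Metric.closedBall (0 : EuclideanSpace ℝ (Fin N)) (2 * R)) :=
      isCompact_closedBall _ _
    have hφc' := hφ1.continuous_fderiv one_ne_zero
    have hφc := hφ1.continuous
    have i1 : Integrable fun x => (U x ^ (-q)) ^ 2 * (K * ‖fderiv ℝ (fun x => η x ^ m) x‖ ^ 2
        - δ * (‖x‖ ^ α / U x ^ 3 * (η x ^ m) ^ 2)) := by
      refine Continuous.integrable_of_hasCompactSupport (by fun_prop (disch := simp [hne]))
        (HasCompactSupport.intro hφs fun x hx => ?_)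
      have e1 : η x ^ m = 0 := image_eq_zero_of_notMem_tsupport (f := fun x => η x ^ m) hx
      have e2 : fderiv ℝ (fun x => η x ^ m) x = 0 :=
        image_eq_zero_of_notMem_tsupport fun h => hx (tsupport_fderiv_subset ℝ h)
      simp [e1, e2]
    have i2 : Integrable fun x => ψ x * g x :=
      (ψ.continuous.mul hgc).integrable_of_hasCompactSupport ψ.hasCompactSupport.mul_right
    have i3 : Integrable ((Metric.closedBall (0 : EuclideanSpace ℝ (Fin N)) (2 * R)).indicator
        fun _ => C * R ^ (-s)) :=
      (integrable_indicator_iff hball.measurableSet).2 (integrableOn_const hball.measure_lt_top.ne)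
    have hvol : ∫ x, (Metric.closedBall (0 : EuclideanSpace ℝ (Fin N)) (2 * R)).indicator
        (fun _ => C * R ^ (-s)) x =
        (C * 2 ^ N * volume.real (Metric.ball (0 : EuclideanSpace ℝ (Fin N)) 1)) *
          R ^ (-(s - N)) := by
      rw [integral_indicator hball.measurableSet, setIntegral_const,
        Measure.addHaar_real_closedBall _ _ (by positivity), finrank_euclideanSpace_fin,
        neg_sub, sub_eq_neg_add, Real.rpow_add hR0, Real.rpow_natCast, smul_eq_mul]
      ring
    rw [← hvol]
    rw [← sub_nonneg, ← integral_sub i3 i2]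
    refine h1.trans (integral_mono i1 (i3.sub i2) fun x => ?_)
    have hp := hpos x
    have ht0 : 0 ≤ (U x ^ (-q)) ^ 2 := sq_nonneg _
    have hRs : 0 ≤ R ^ (-s) := Real.rpow_nonneg hR0.le _
    -- For `R ≥ 2` the large cutoff equals `1` wherever the fixed bump `ψ` is nonzero, so the left
    -- side does not depend on `R`.
    have hψη : ψ x ≤ η x ^ (2 * m) := by
      rcases le_or_gt ‖x‖ 2 with h | h
      · rw [hηone x (h.trans hR), one_pow]; exact ψ.le_one
      · rw [ψ.zero_of_le_dist (by rw [dist_zero_right]; exact h.le)]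
        exact pow_nonneg (hη0 x) _
    have hψg' : ψ x * g x ≤ δ / 2 * ((U x ^ (-q)) ^ 2 * (‖x‖ ^ α / U x ^ 3 * η x ^ (2 * m))) := by
      calc _ ≤ η x ^ (2 * m) * g x := mul_le_mul_of_nonneg_right hψη (hg0 x)
        _ = _ := by rw [hg]; ring
    set A := (U x ^ (-q)) ^ 2 * (‖x‖ ^ α / U x ^ 3 * η x ^ (2 * m)) with hA
    have hgrad : (U x ^ (-q)) ^ 2 * (K * ‖fderiv ℝ (fun x => η x ^ m) x‖ ^ 2) ≤ δ / 2 * A +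
        (Metric.closedBall (0 : EuclideanSpace ℝ (Fin N)) (2 * R)).indicator
          (fun _ => C * R ^ (-s)) x := by
      have hA0 : 0 ≤ A := by have := hη0 x; positivity
      have hind : 0 ≤ (Metric.closedBall (0 : EuclideanSpace ℝ (Fin N)) (2 * R)).indicator
          (fun _ => C * R ^ (-s)) x := Set.indicator_nonneg (fun _ _ => by positivity) _
      -- Three regions: for `‖x‖ < R` the cutoff is locally constant; on `R ≤ ‖x‖ ≤ 2R` the weight
      -- is at least `R^α` and Young's inequality applies; beyond `2R` the factor `η^(m-1)` vanishes
      -- since `m > 1`.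
      rcases lt_or_ge ‖x‖ R with hxR | hxR
      · have : fderiv ℝ (fun x => η x ^ m) x = 0 := by
          have : (fun x => η x ^ m) =ᶠ[nhds x] fun _ => 1 := by
            filter_upwards [(continuous_norm.tendsto x).eventually (gt_mem_nhds hxR)] with z hz
            rw [hηone z hz.le, one_pow]
          rw [this.fderiv_eq]; simp
        rw [this]
        simp only [norm_zero]
        have : 0 ≤ δ / 2 * A := by positivity
        linarith
      by_cases hxb : x ∈ Metric.closedBall (0 : EuclideanSpace ℝ (Fin N)) (2 * R)
      · rw [Set.indicator_of_mem hxb]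
        have h2 : ‖fderiv ℝ (fun x => η x ^ m) x‖ ^ 2 ≤
            (m * M) ^ 2 * (R⁻¹ ^ 2 * η x ^ (2 * m - 2)) := by
          have : ‖fderiv ℝ (fun x => η x ^ m) x‖ ≤ m * η x ^ (m - 1) * (R⁻¹ * M) := by
            rw [hd, norm_smul, Real.norm_of_nonneg (by have := hη0 x; positivity)]
            have := hη0 x
            gcongr; exact hdη x
          calc _ ≤ (m * η x ^ (m - 1) * (R⁻¹ * M)) ^ 2 := by gcongr
            _ = _ := by
              rw [show 2 * m - 2 = (m - 1) * 2 by omega, pow_mul]; ring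
        have h3 := cutoff_le_geom_mean (α := α) hq hR0 hp (hη0 x) (hηle x) hm
        have hA' : (U x ^ (-q)) ^ 2 * (R ^ α / U x ^ 3 * η x ^ (2 * m)) ≤ A := by
          have := hη0 x
          rw [hA]; gcongr
        have hA0' : 0 ≤ (U x ^ (-q)) ^ 2 * (R ^ α / U x ^ 3 * η x ^ (2 * m)) := by
          have := hη0 x; positivity
        have h4 := hC _ (R ^ (-s)) hA0' hRs
        calc _ ≤ (U x ^ (-q)) ^ 2 * (K * ((m * M) ^ 2 * (R⁻¹ ^ 2 * η x ^ (2 * m - 2)))) := by gcongr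
          _ = K * (m * M) ^ 2 * (R⁻¹ ^ 2 * (U x ^ (-q)) ^ 2 * η x ^ (2 * m - 2)) := by ring
          _ ≤ _ := mul_le_mul_of_nonneg_left h3 (by positivity)
          _ ≤ _ := h4
          _ ≤ _ := by gcongr
      · have : η x = 0 := hηout x hxb
        have hm1 : m - 1 ≠ 0 := by
          have h5 : (1 : ℝ) < m :=
            lt_of_lt_of_le (by rw [lt_div_iff₀ (by norm_num)]; linarith) hm
          have : 1 < m := by exact_mod_cast h5
          omega
        rw [hd, this, zero_pow hm1]
        simp only [mul_zero, zero_smul, norm_zero]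
        have : 0 ≤ δ / 2 * A := by positivity
        linarith
    have hsplit : (U x ^ (-q)) ^ 2 * (K * ‖fderiv ℝ (fun x => η x ^ m) x‖ ^ 2
        - δ * (‖x‖ ^ α / U x ^ 3 * (η x ^ m) ^ 2)) =
        (U x ^ (-q)) ^ 2 * (K * ‖fderiv ℝ (fun x => η x ^ m) x‖ ^ 2) - δ * A := by
      rw [hA, mul_comm 2 m, pow_mul]; ring
    change (U x ^ (-q)) ^ 2 * _ ≤ _ - ψ x * g x
    rw [hsplit]
    linarith
  -- The volume `R^N` of the ball loses against `R^{-s}` because `s > N`.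
  have hlim := (tendsto_rpow_neg_atTop (sub_pos.2 hqN)).const_mul
    (C * 2 ^ N * volume.real (Metric.ball (0 : EuclideanSpace ℝ (Fin N)) 1))
  rw [mul_zero] at hlim
  exact hψg.not_ge (ge_of_tendsto hlim ((Filter.eventually_ge_atTop 2).mono hbound))

/-! ### Existence of the regular radial solution in the variable `s = r²`. -/

/-- The function `s ↦ ¼ ∫₀¹ τ^{N/2-1} g(sτ) dτ`, which solves `s w' + (N/2) w = g/4`. -/
noncomputable def radialAverage (N : ℕ) (g : ℝ → ℝ) (s : ℝ) : ℝ :=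
  1 / 4 * ∫ τ in (0 : ℝ)..1, τ ^ ((N : ℝ) / 2 - 1) * g (s * τ)

section radialAverage

variable {N : ℕ} {g : ℝ → ℝ}

lemma continuous_rpow_weight (hN : 2 ≤ N) : Continuous fun τ : ℝ => τ ^ ((N : ℝ) / 2 - 1) := by
  have : (2 : ℝ) ≤ N := by exact_mod_cast hN
  exact Real.continuous_rpow_const (by linarith)

lemma integral_rpow_weight (hN : 2 ≤ N) :
    ∫ τ in (0 : ℝ)..1, τ ^ ((N : ℝ) / 2 - 1) = 2 / N := by
  have h2 : (2 : ℝ) ≤ N := by exact_mod_cast hN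
  rw [integral_rpow (Or.inl (by linarith)), sub_add_cancel, Real.one_rpow,
    Real.zero_rpow (by positivity), sub_zero, one_div_div]

lemma continuous_radialAverage (hN : 2 ≤ N) (hg : Continuous g) :
    Continuous (radialAverage N g) := by
  have := continuous_rpow_weight hN
  unfold radialAverage
  refine continuous_const.mul ?_
  exact intervalIntegral.continuous_parametric_intervalIntegral_of_continuous' (by fun_prop) _ _

lemma radialAverage_zero (hN : 2 ≤ N) : radialAverage N g 0 = g 0 / (2 * N) := by
  have h2 : (2 : ℝ) ≤ N := by exact_mod_cast hN
  simp only [radialAverage, zero_mul, intervalIntegral.integral_mul_const, integral_rpow_weight hN]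
  field_simp
  norm_num

lemma radialAverage_sub (hN : 2 ≤ N) {h : ℝ → ℝ} (hg : Continuous g) (hh : Continuous h) (s : ℝ) :
    radialAverage N g s - radialAverage N h s = radialAverage N (fun t => g t - h t) s := by
  have := continuous_rpow_weight hN
  simp only [radialAverage, mul_sub]
  rw [intervalIntegral.integral_sub]
  · ring
  · exact Continuous.intervalIntegrable (by fun_prop) _ _
  · exact Continuous.intervalIntegrable (by fun_prop) _ _

/-- The factor is the total mass `¼ · 2/N` of the weight. Only values of `g` on `[0, s]` enter,
which makes the exponentially weighted contraction possible. -/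
lemma abs_radialAverage_le (hN : 2 ≤ N) {s B : ℝ} (hs : 0 ≤ s)
    (hB : ∀ t, 0 ≤ t → t ≤ s → |g t| ≤ B) : |radialAverage N g s| ≤ B / (2 * N) := by
  have h2 : (2 : ℝ) ≤ N := by exact_mod_cast hN
  have hw := continuous_rpow_weight hN
  have h := intervalIntegral.norm_integral_le_of_norm_le (μ := volume) zero_le_one
    (f := fun τ : ℝ => τ ^ ((N : ℝ) / 2 - 1) * g (s * τ))
    (g := fun τ : ℝ => τ ^ ((N : ℝ) / 2 - 1) * B) (Filter.Eventually.of_forall fun τ hτ => by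
      rw [norm_mul, Real.norm_of_nonneg (Real.rpow_nonneg hτ.1.le _)]
      refine mul_le_mul_of_nonneg_left ?_ (Real.rpow_nonneg hτ.1.le _)
      exact hB _ (mul_nonneg hs hτ.1.le) (mul_le_of_le_one_right hs hτ.2))
    (Continuous.intervalIntegrable (by fun_prop) _ _)
  rw [intervalIntegral.integral_mul_const, integral_rpow_weight hN, Real.norm_eq_abs] at h
  rw [radialAverage, abs_mul, abs_of_nonneg (by norm_num : (0 : ℝ) ≤ 1 / 4)]
  calc _ ≤ 1 / 4 * (2 / N * B) := by gcongr
    _ = _ := by field_simp; norm_num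

lemma radialAverage_nonneg {s : ℝ} (hs : 0 ≤ s) (hg : ∀ t, 0 ≤ t → 0 ≤ g t) :
    0 ≤ radialAverage N g s :=
  mul_nonneg (by norm_num) <| intervalIntegral.integral_nonneg zero_le_one fun τ hτ =>
    mul_nonneg (Real.rpow_nonneg hτ.1 _) (hg _ (mul_nonneg hs hτ.1))

/-- The substitution `t = sτ` moves `s` out of the argument of `g`, so the average can be
differentiated for merely continuous `g`. -/
lemma radialAverage_eq {s : ℝ} (hs : 0 < s) :
    radialAverage N g s =
      1 / 4 * (s ^ (-((N : ℝ) / 2)) * ∫ t in (0 : ℝ)..s, t ^ ((N : ℝ) / 2 - 1) * g t) := by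
  have h := intervalIntegral.integral_comp_mul_left (a := 0) (b := 1) (c := s)
    (fun t => t ^ ((N : ℝ) / 2 - 1) * g t) hs.ne'
  rw [mul_zero, mul_one, smul_eq_mul, inv_mul_eq_div, eq_div_iff hs.ne'] at h
  rw [radialAverage, ← h]
  have h3 : ∫ τ in (0 : ℝ)..1, (s * τ) ^ ((N : ℝ) / 2 - 1) * g (s * τ) =
      s ^ ((N : ℝ) / 2 - 1) * ∫ τ in (0 : ℝ)..1, τ ^ ((N : ℝ) / 2 - 1) * g (s * τ) := by
    rw [← intervalIntegral.integral_const_mul]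
    refine intervalIntegral.integral_congr fun τ hτ => ?_
    rw [Set.uIcc_of_le zero_le_one] at hτ
    simp only [Real.mul_rpow hs.le hτ.1, mul_assoc]
  rw [h3]
  have h4 : s ^ (-((N : ℝ) / 2)) * (s ^ ((N : ℝ) / 2 - 1) * s) = 1 := by
    rw [← Real.rpow_add_one hs.ne', ← Real.rpow_add hs]
    simp
  linear_combination (-(1 / 4) * ∫ τ in (0 : ℝ)..1, τ ^ ((N : ℝ) / 2 - 1) * g (s * τ)) * h4

lemma hasDerivAt_radialAverage (hN : 2 ≤ N) (hg : Continuous g) {s : ℝ} (hs : 0 < s) :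
    HasDerivAt (radialAverage N g) ((g s / 4 - N / 2 * radialAverage N g s) / s) s := by
  have hw := continuous_rpow_weight hN
  have hc : Continuous fun t : ℝ => t ^ ((N : ℝ) / 2 - 1) * g t := by fun_prop
  have h1 := hc.integral_hasStrictDerivAt 0 s |>.hasDerivAt
  have h2 := Real.hasDerivAt_rpow_const (x := s) (p := -((N : ℝ) / 2)) (Or.inl hs.ne')
  have h3 := (h2.mul h1).const_mul (1 / 4)
  refine (h3.congr_of_eventuallyEq ?_).congr_deriv ?_
  · filter_upwards [lt_mem_nhds hs] with t ht
    rw [radialAverage_eq ht]; rfl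
  · rw [radialAverage_eq hs]
    have h4 : s ^ (-((N : ℝ) / 2)) * (s ^ ((N : ℝ) / 2 - 1)) = s⁻¹ := by
      rw [← Real.rpow_add hs, ← Real.rpow_neg_one]
      congr 1; ring
    rw [Real.rpow_sub_one hs.ne' (-((N : ℝ) / 2))]
    linear_combination (1 / 4 * g s) * h4

end radialAverage

/-- The regularized nonlinearity `x ↦ max(1, x)⁻²`. -/
noncomputable def truncInvSq (x : ℝ) : ℝ := (max 1 x ^ 2)⁻¹

lemma continuous_truncInvSq : Continuous truncInvSq := by
  unfold truncInvSq
  exact Continuous.inv₀ (by fun_prop) fun x => by positivity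

lemma truncInvSq_nonneg (x : ℝ) : 0 ≤ truncInvSq x := by unfold truncInvSq; positivity

lemma truncInvSq_le_one (x : ℝ) : truncInvSq x ≤ 1 :=
  inv_le_one_of_one_le₀ (one_le_pow₀ (le_max_left _ _))

lemma abs_truncInvSq_sub_le (x y : ℝ) : |truncInvSq x - truncInvSq y| ≤ 2 * |x - y| := by
  unfold truncInvSq
  have hx : 1 ≤ max 1 x := le_max_left _ _
  have hy : 1 ≤ max 1 y := le_max_left _ _
  have hxy : |max 1 x - max 1 y| ≤ |x - y| :=
    (abs_max_sub_max_le_max 1 x 1 y).trans (by simp)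
  set p := max 1 x
  set q := max 1 y
  have hp : p ≠ 0 := by positivity
  have hq : q ≠ 0 := by positivity
  have e : (p ^ 2)⁻¹ - (q ^ 2)⁻¹ = (q - p) * ((p + q) / (p ^ 2 * q ^ 2)) := by
    field_simp; ring
  have h1 : (p + q) / (p ^ 2 * q ^ 2) ≤ 2 := by
    rw [div_le_iff₀ (by positivity)]
    have h1 : p ≤ p ^ 2 * q ^ 2 := by
      calc p ≤ p ^ 2 := by nlinarith
        _ ≤ _ := le_mul_of_one_le_right (by positivity) (one_le_pow₀ hy)
    have h2 : q ≤ p ^ 2 * q ^ 2 := by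
      calc q ≤ q ^ 2 := by nlinarith
        _ ≤ _ := le_mul_of_one_le_left (by positivity) (one_le_pow₀ hx)
    linarith
  rw [e, abs_mul, abs_sub_comm, abs_of_nonneg (by positivity : 0 ≤ (p + q) / (p ^ 2 * q ^ 2)),
    mul_comm 2]
  gcongr

/-- Existence for the integral form of the radial equation, by a contraction in an exponentially
weighted space. -/
theorem exists_radial_fixedPoint {N : ℕ} (hN : 2 ≤ N) {a : ℝ} (ha : 0 ≤ a) :
    ∃ v : ℝ → ℝ, Continuous v ∧ ∀ s, 0 ≤ s →
      v s = 1 + ∫ σ in (0 : ℝ)..s, radialAverage N (fun t => |t| ^ a * truncInvSq (v t)) σ := by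
  have h2 : (2 : ℝ) ≤ N := by exact_mod_cast hN
  have hac : Continuous fun t : ℝ => |t| ^ a := continuous_abs.rpow_const fun _ => Or.inr ha
  have hfc := continuous_truncInvSq
  -- The unknown is written `v = 1 + e^Λ z` with `z` bounded; since `Λ' = |s|^a`, the weight `e^Λ`
  -- integrates exactly against the Lipschitz bound.
  set Λ : ℝ → ℝ := fun s => ∫ t in (0 : ℝ)..s, |t| ^ a with hΛ
  have hΛd : ∀ s, HasDerivAt Λ (|s| ^ a) s := fun s => (hac.integral_hasStrictDerivAt 0 s).hasDerivAt
  have hΛc : Continuous Λ := continuous_iff_continuousAt.2 fun s => (hΛd s).continuousAt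
  have hΛm : Monotone Λ := monotone_of_deriv_nonneg (fun s => (hΛd s).differentiableAt) fun s => by
    rw [(hΛd s).deriv]; positivity
  have hΛ0 : Λ 0 = 0 := by simp [hΛ]
  let G : BoundedContinuousFunction ℝ ℝ → ℝ → ℝ := fun z t =>
    |t| ^ a * truncInvSq (1 + Real.exp (Λ t) * z t)
  have hGc : ∀ z, Continuous (G z) := fun z => by
    have := z.continuous
    fun_prop
  have hwc : ∀ z, Continuous (radialAverage N (G z)) := fun z => continuous_radialAverage hN (hGc z)
  have hGb : ∀ z t s, 0 ≤ t → t ≤ s → |G z t| ≤ |s| ^ a := fun z t s ht hts => by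
    rw [abs_of_nonneg (mul_nonneg (by positivity) (truncInvSq_nonneg _))]
    calc _ ≤ |t| ^ a * 1 := by gcongr; exact truncInvSq_le_one _
      _ ≤ _ := by
        rw [mul_one, abs_of_nonneg ht, abs_of_nonneg (ht.trans hts)]; gcongr
  -- Freezing the upper limit at `0` for negative `s` defines the map on bounded functions on the
  -- whole line; only `s ≥ 0` matters.
  let S : BoundedContinuousFunction ℝ ℝ → ℝ → ℝ := fun z s =>
    Real.exp (-Λ s) * ∫ σ in (0 : ℝ)..max s 0, radialAverage N (G z) σ
  have hSc : ∀ z, Continuous (S z) := fun z => by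
    have h1 : Continuous fun s => ∫ σ in (0 : ℝ)..s, radialAverage N (G z) σ :=
      continuous_iff_continuousAt.2 fun s =>
        ((hwc z).integral_hasStrictDerivAt 0 s).hasDerivAt.continuousAt
    have h2 : Continuous fun s : ℝ => max s 0 := by fun_prop
    have h3 := h1.comp h2
    exact (Real.continuous_exp.comp hΛc.neg).mul h3
  have hSb : ∀ z s, ‖S z s‖ ≤ 1 := fun z s => by
    rcases le_or_gt s 0 with hs | hs
    · simp [S, max_eq_right hs]
    · have h1 : |∫ σ in (0 : ℝ)..s, radialAverage N (G z) σ| ≤ ∫ σ in (0 : ℝ)..s, |σ| ^ a := by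
        rw [← Real.norm_eq_abs]
        refine intervalIntegral.norm_integral_le_of_norm_le hs.le
          (Filter.Eventually.of_forall fun σ hσ => ?_) (hac.intervalIntegrable _ _)
        refine (abs_radialAverage_le hN hσ.1.le fun t ht hts => hGb z t σ ht hts).trans ?_
        exact div_le_self (by positivity) (by linarith)
      have h3 : Λ s ≤ Real.exp (Λ s) := by linarith [Real.add_one_le_exp (Λ s)]
      simp only [S, max_eq_left hs.le, norm_mul, Real.norm_eq_abs, abs_of_pos (Real.exp_pos _)]
      calc _ ≤ Real.exp (-Λ s) * Real.exp (Λ s) := by gcongr; exact h1.trans h3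
        _ = 1 := by rw [← Real.exp_add]; simp
  let T : BoundedContinuousFunction ℝ ℝ → BoundedContinuousFunction ℝ ℝ := fun z =>
    BoundedContinuousFunction.ofNormedAddCommGroup (S z) (hSc z) 1 (hSb z)
  have hTc : ContractingWith (1 / 2) T := by
    refine ⟨by norm_num, LipschitzWith.of_dist_le_mul fun z y => ?_⟩
    push_cast
    rw [BoundedContinuousFunction.dist_le (by positivity)]
    intro s
    change dist (S z s) (S y s) ≤ _
    rcases le_or_gt s 0 with hs | hs
    · simp only [S, max_eq_right hs, intervalIntegral.integral_same, mul_zero, dist_self]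
      positivity
    · have hd : ∀ t, |z t - y t| ≤ dist z y := fun t => by
        rw [← Real.dist_eq]
        exact BoundedContinuousFunction.dist_coe_le_dist t
      have hpt : ∀ σ, 0 ≤ σ → |radialAverage N (G z) σ - radialAverage N (G y) σ| ≤
          1 / 2 * dist z y * (|σ| ^ a * Real.exp (Λ σ)) := fun σ hσ => by
        rw [radialAverage_sub hN (hGc z) (hGc y)]
        refine (abs_radialAverage_le hN (B := |σ| ^ a * (2 * (Real.exp (Λ σ) * dist z y))) hσ
          fun t ht hts => ?_).trans ?_
        · simp only [G]
          rw [← mul_sub, abs_mul, abs_of_nonneg (by positivity : 0 ≤ |t| ^ a)]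
          have h1 := abs_truncInvSq_sub_le (1 + Real.exp (Λ t) * z t) (1 + Real.exp (Λ t) * y t)
          rw [add_sub_add_left_eq_sub, ← mul_sub, abs_mul, abs_of_pos (Real.exp_pos _)] at h1
          have h3 : |t| ^ a ≤ |σ| ^ a := by
            rw [abs_of_nonneg ht, abs_of_nonneg hσ]; gcongr
          refine mul_le_mul h3 (h1.trans ?_) (abs_nonneg _) (by positivity)
          have := hΛm hts
          gcongr
          exact hd t
        -- The Lipschitz constant `2` of the nonlinearity times `1/(2N)` is at most `1/2`, as `N ≥
        -- 2`.
        · rw [div_le_iff₀ (by positivity)]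
          have h0 : 0 ≤ |σ| ^ a * (Real.exp (Λ σ) * dist z y) := by positivity
          nlinarith
      have hec : Continuous fun σ => |σ| ^ a * Real.exp (Λ σ) := by fun_prop
      have hint : ∫ σ in (0 : ℝ)..s, |σ| ^ a * Real.exp (Λ σ) = Real.exp (Λ s) - 1 := by
        rw [intervalIntegral.integral_eq_sub_of_hasDerivAt (f := fun σ => Real.exp (Λ σ))
          (fun σ _ => by simpa [mul_comm] using (hΛd σ).exp) (hec.intervalIntegrable _ _), hΛ0,
          Real.exp_zero]
      have hI : |∫ σ in (0 : ℝ)..s, (radialAverage N (G z) σ - radialAverage N (G y) σ)| ≤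
          1 / 2 * dist z y * (Real.exp (Λ s) - 1) := by
        rw [← hint, ← intervalIntegral.integral_const_mul, ← Real.norm_eq_abs]
        exact intervalIntegral.norm_integral_le_of_norm_le hs.le
          (Filter.Eventually.of_forall fun σ hσ => hpt σ hσ.1.le)
          (Continuous.intervalIntegrable (by fun_prop) _ _)
      simp only [S, max_eq_left hs.le]
      rw [Real.dist_eq, ← mul_sub, ← intervalIntegral.integral_sub
        ((hwc z).intervalIntegrable _ _) ((hwc y).intervalIntegrable _ _), abs_mul,
        abs_of_pos (Real.exp_pos _)]
      calc _ ≤ Real.exp (-Λ s) * (1 / 2 * dist z y * Real.exp (Λ s)) := by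
            gcongr
            refine hI.trans ?_
            gcongr
            linarith
        _ = 1 / 2 * dist z y * (Real.exp (-Λ s) * Real.exp (Λ s)) := by ring
        _ = 1 / 2 * dist z y := by rw [← Real.exp_add]; simp
  have hfix : T (hTc.fixedPoint T) = hTc.fixedPoint T := hTc.fixedPoint_isFixedPt
  set z := hTc.fixedPoint T
  have hzc := z.continuous
  refine ⟨fun s => 1 + Real.exp (Λ s) * z s, by fun_prop, fun s hs => ?_⟩
  have h1 : S z s = z s := congrArg (fun u : BoundedContinuousFunction ℝ ℝ => u s) hfix
  simp only [S, max_eq_left hs] at h1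
  simp only
  rw [← h1, ← mul_assoc, ← Real.exp_add, add_neg_cancel, Real.exp_zero, one_mul]

/-- The regular solution of the radial equation, in the variable `s = r²`. -/
theorem exists_radial_solution {N : ℕ} (hN : 2 ≤ N) {a : ℝ} (ha : 0 ≤ a) :
    ∃ V w : ℝ → ℝ, Continuous w ∧ (∀ s, HasDerivAt V (w s) s) ∧ V 0 = 1 ∧
      (∀ s, 0 ≤ s → 1 ≤ V s) ∧ w 0 = 0 ^ a / (2 * N) ∧
      ∀ s, 0 < s → HasDerivAt w ((s ^ a / V s ^ 2 / 4 - N / 2 * w s) / s) s := by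
  obtain ⟨v, hv, hv1⟩ := exists_radial_fixedPoint hN ha
  have hac : Continuous fun t : ℝ => |t| ^ a := continuous_abs.rpow_const fun _ => Or.inr ha
  have hfc := continuous_truncInvSq
  set g : ℝ → ℝ := fun t => |t| ^ a * truncInvSq (v t) with hg
  have hgc : Continuous g := by fun_prop
  have hw := continuous_radialAverage hN hgc
  have hw0 : ∀ s, 0 ≤ s → 0 ≤ radialAverage N g s := fun s hs =>
    radialAverage_nonneg hs fun t _ => mul_nonneg (by positivity) (truncInvSq_nonneg _)
  set V : ℝ → ℝ := fun s => 1 + ∫ σ in (0 : ℝ)..s, radialAverage N g σ with hV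
  -- The derivative of `V` is nonnegative, so `V ≥ 1` and the truncation is inactive along the
  -- solution.
  have hV1 : ∀ s, 0 ≤ s → 1 ≤ V s := fun s hs => by
    have := intervalIntegral.integral_nonneg (μ := volume) hs fun σ hσ => hw0 σ hσ.1
    simp only [hV]; linarith
  have hgV : ∀ s, 0 ≤ s → g s = s ^ a / V s ^ 2 := fun s hs => by
    have h1 : v s = V s := hv1 s hs
    simp only [hg, truncInvSq, h1, max_eq_right (hV1 s hs), abs_of_nonneg hs, div_eq_mul_inv]
  refine ⟨V, radialAverage N g, hw, fun s => ?_, by simp [hV], hV1, ?_, fun s hs => ?_⟩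
  · exact (hw.integral_hasStrictDerivAt 0 s).hasDerivAt.const_add 1
  · rw [radialAverage_zero hN, hgV 0 le_rfl]
    simp [hV]
  · rw [← hgV s hs.le]
    exact hasDerivAt_radialAverage hN hgc hs

/-! ### Regularity of the radial function at the origin. -/

/-- A function `y ↦ V(‖y‖²)` with `V' = w`, where `s w'(s)` extends continuously by `0` to `s = 0`,
is `C²`, and its Laplacian is given by the radial formula. -/
theorem contDiff_two_radial {N : ℕ} {V w h : ℝ → ℝ} (hw : Continuous w) (hh : Continuous h)
    (hh0 : h 0 = 0) (hV : ∀ s, HasDerivAt V (w s) s)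
    (hw' : ∀ s, 0 < s → HasDerivAt w (h s / s) s) :
    ContDiff ℝ 2 (fun y : EuclideanSpace ℝ (Fin N) => V (‖y‖ ^ 2)) ∧
    ∀ y : EuclideanSpace ℝ (Fin N),
      Laplacian.laplacian (fun y : EuclideanSpace ℝ (Fin N) => V (‖y‖ ^ 2)) y =
      2 * N * w (‖y‖ ^ 2) + 4 * h (‖y‖ ^ 2) := by
  have hsq : ∀ y : EuclideanSpace ℝ (Fin N), HasFDerivAt (fun y => ‖y‖ ^ 2) (2 • innerSL ℝ y) y :=
    fun y => (hasStrictFDerivAt_norm_sq y).hasFDerivAt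
  have hpos : ∀ y : EuclideanSpace ℝ (Fin N), y ≠ 0 → 0 < ‖y‖ ^ 2 := fun y hy => by
    have := norm_pos_iff.2 hy; positivity
  set Y : EuclideanSpace ℝ (Fin N) → EuclideanSpace ℝ (Fin N) := fun y => (2 * w (‖y‖ ^ 2)) • y
  set D : EuclideanSpace ℝ (Fin N) → EuclideanSpace ℝ (Fin N) →L[ℝ] EuclideanSpace ℝ (Fin N) :=
    fun y => (2 * w (‖y‖ ^ 2)) • ContinuousLinearMap.id ℝ _ +
      (4 * (h (‖y‖ ^ 2) / ‖y‖ ^ 2)) • (innerSL ℝ y).smulRight y with hD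
  have hU : ∀ y : EuclideanSpace ℝ (Fin N), HasFDerivAt (fun y => V (‖y‖ ^ 2))
      (InnerProductSpace.toDual ℝ _ (Y y)) y := fun y => by
    refine ((hV (‖y‖ ^ 2)).comp_hasFDerivAt y (hsq y)).congr_fderiv ?_
    ext v
    simp [Y]
    ring
  have hY : ∀ y, HasFDerivAt Y (D y) y := fun y => by
    rcases eq_or_ne y 0 with rfl | hy
    -- At the origin `Y(y) - 2w(0) y = o(y)` by continuity of `w` alone; the rank-one term of `D` is
    -- zero there.
    · have hc : Filter.Tendsto (fun y : EuclideanSpace ℝ (Fin N) => 2 * w (‖y‖ ^ 2) - 2 * w 0)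
          (nhds 0) (nhds 0) := by
        have : Continuous fun y : EuclideanSpace ℝ (Fin N) => 2 * w (‖y‖ ^ 2) - 2 * w 0 := by
          fun_prop
        simpa using this.tendsto 0
      rw [hasFDerivAt_iff_isLittleO_nhds_zero]
      have h1 := ((Asymptotics.isLittleO_one_iff ℝ).2 hc).smul_isBigO
        (Asymptotics.isBigO_refl (fun y : EuclideanSpace ℝ (Fin N) => y) (nhds 0))
      simpa [Y, D, sub_smul] using h1
    · refine (((((hw' _ (hpos y hy)).comp_hasFDerivAt y (hsq y)).const_mul 2).smul
        (hasFDerivAt_id y))).congr_fderiv ?_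
      ext v i
      simp [D]
      ring
  have hDc : Continuous D := by
    refine continuous_iff_continuousAt.2 fun y => ?_
    have c1 : Continuous fun y : EuclideanSpace ℝ (Fin N) =>
        (2 * w (‖y‖ ^ 2)) • ContinuousLinearMap.id ℝ (EuclideanSpace ℝ (Fin N)) := by fun_prop
    refine c1.continuousAt.add ?_
    have c3 : Continuous fun y : EuclideanSpace ℝ (Fin N) => (innerSL ℝ y).smulRight y := by
      have := (innerSL ℝ (E := EuclideanSpace ℝ (Fin N))).continuous
      fun_prop
    rcases eq_or_ne y 0 with rfl | hy
    · rw [ContinuousAt]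
      have hz : (4 * (h (‖(0 : EuclideanSpace ℝ (Fin N))‖ ^ 2) /
          ‖(0 : EuclideanSpace ℝ (Fin N))‖ ^ 2)) •
          (innerSL ℝ (0 : EuclideanSpace ℝ (Fin N))).smulRight (0 : EuclideanSpace ℝ (Fin N)) = 0 := by
        simp
      rw [hz]
      have hb : Filter.Tendsto (fun y : EuclideanSpace ℝ (Fin N) => 4 * |h (‖y‖ ^ 2)|)
          (nhds 0) (nhds 0) := by
        have : Continuous fun y : EuclideanSpace ℝ (Fin N) => 4 * |h (‖y‖ ^ 2)| := by fun_prop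
        simpa [hh0] using this.tendsto 0
      -- The rank-one operator has norm `‖y‖²`, which cancels the denominator and leaves
      -- `4|h(‖y‖²)|`, tending to `h(0) = 0`.
      refine squeeze_zero_norm (fun y => ?_) hb
      rw [norm_smul, ContinuousLinearMap.norm_smulRight_apply, innerSL_apply_norm,
        Real.norm_eq_abs, abs_mul, abs_div, abs_of_pos (by norm_num : (0 : ℝ) < 4),
        abs_of_nonneg (sq_nonneg ‖y‖), mul_assoc, ← sq]
      gcongr
      rcases eq_or_ne y 0 with rfl | hy
      · simp
      · rw [div_mul_cancel₀ _ (hpos y hy).ne']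
    · have c2 : ContinuousAt (fun y : EuclideanSpace ℝ (Fin N) => 4 * (h (‖y‖ ^ 2) / ‖y‖ ^ 2)) y :=
        ContinuousAt.mul continuousAt_const (ContinuousAt.div (by fun_prop) (by fun_prop)
          (hpos y hy).ne')
      exact c2.smul c3.continuousAt
  have hY1 : ContDiff ℝ 1 Y := contDiff_one_iff_hasFDerivAt.2 ⟨D, hDc, hY⟩
  have hU2 : ContDiff ℝ 2 (fun y : EuclideanSpace ℝ (Fin N) => V (‖y‖ ^ 2)) := by
    rw [show (2 : WithTop ℕ∞) = 1 + 1 by norm_num, contDiff_succ_iff_fderiv]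
    refine ⟨fun y => (hU y).differentiableAt, by simp, ?_⟩
    rw [show fderiv ℝ (fun y : EuclideanSpace ℝ (Fin N) => V (‖y‖ ^ 2)) =
      (InnerProductSpace.toDual ℝ _) ∘ Y from funext fun y => (hU y).fderiv]
    exact (InnerProductSpace.toDual ℝ (EuclideanSpace ℝ (Fin N))).contDiff.comp hY1
  refine ⟨hU2, fun y => ?_⟩
  have hg : gradient (fun y : EuclideanSpace ℝ (Fin N) => V (‖y‖ ^ 2)) = Y :=
    funext fun y => HasGradientAt.gradient (hU y)
  rw [laplacian_eq_divergence_gradient hU2, hg, divergence]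
  simp only [(hY y).fderiv]
  have h1 : ∀ i, D y (EuclideanSpace.single i 1) i =
      2 * w (‖y‖ ^ 2) + 4 * (h (‖y‖ ^ 2) / ‖y‖ ^ 2) * y i ^ 2 := fun i => by
    simp [D, EuclideanSpace.inner_single_right]
    exact Or.inl (by ring)
  simp only [h1, Finset.sum_add_distrib, ← Finset.mul_sum]
  have h2 : ∑ i, y i ^ 2 = ‖y‖ ^ 2 := by
    rw [EuclideanSpace.norm_sq_eq]; simp
  rw [h2, Finset.sum_const, Finset.card_univ, Fintype.card_fin, nsmul_eq_mul]
  rcases eq_or_ne y 0 with rfl | hy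
  · simp [hh0]; ring
  · have := (hpos y hy).ne'
    field_simp

/-! ### Comparison with the singular solution. -/

/-- In the Joseph–Lundgren range the regular radial solution stays above the singular one. -/
theorem singular_le_radial {n a γ c : ℝ} {V w : ℝ → ℝ} (hn : 2 < n) (hγ : 0 < γ)
    (haγ : a = 3 * (γ / 2) - 1) (hc : 0 < c) (hcγ : c ^ 3 * (γ * (γ + (n - 2))) = 1)
    (hJL : γ * (γ + (n - 2)) ≤ 2 * ((n - 2) / 4) ^ 2)
    (hw : Continuous w) (hV : ∀ s, HasDerivAt V (w s) s) (hV0 : V 0 = 1)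
    (hV1 : ∀ s, 0 ≤ s → 1 ≤ V s)
    (hw' : ∀ s, 0 < s → HasDerivAt w ((s ^ a / V s ^ 2 / 4 - n / 2 * w s) / s) s)
    {s : ℝ} (hs : 0 ≤ s) : c * s ^ (γ / 2) ≤ V s := by
  set b := (n - 2) / 4 with hb
  have hb0 : 0 < b := by rw [hb]; linarith
  have hVc : Continuous V := continuous_iff_continuousAt.2 fun s => (hV s).continuousAt
  have hpc : Continuous fun s : ℝ => s ^ (γ / 2) := Real.continuous_rpow_const (by positivity)
  have hbc : Continuous fun s : ℝ => s ^ b := Real.continuous_rpow_const hb0.le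
  set W : ℝ → ℝ := fun s => V s - c * s ^ (γ / 2) with hW
  have hWc : Continuous W := by fun_prop
  -- `P = s (s^b W)'` for `s > 0`. The factor `s^b = r^{(n-2)/2}` removes the first-order term of
  -- the Euler operator, so `s^{1-b} P'` contains only `b² W` and the nonlinear difference.
  set P : ℝ → ℝ := fun s => s ^ b * (s * w s - c * (γ / 2) * s ^ (γ / 2) + b * W s) with hP
  have hPc : Continuous P := by fun_prop
  have hpd : ∀ s, 0 < s → HasDerivAt (fun s : ℝ => s ^ (γ / 2)) (γ / 2 * (s ^ (γ / 2) / s)) s :=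
    fun s hs => by
      have := Real.hasDerivAt_rpow_const (x := s) (p := γ / 2) (Or.inl hs.ne')
      rwa [Real.rpow_sub_one hs.ne'] at this
  have hbd : ∀ s, 0 < s → HasDerivAt (fun s : ℝ => s ^ b) (b * (s ^ b / s)) s :=
    fun s hs => by
      have := Real.hasDerivAt_rpow_const (x := s) (p := b) (Or.inl hs.ne')
      rwa [Real.rpow_sub_one hs.ne'] at this
  have hWd : ∀ s, 0 < s → HasDerivAt W (w s - c * (γ / 2 * (s ^ (γ / 2) / s))) s := fun s hs =>
    (hV s).sub ((hpd s hs).const_mul c)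
  have hPd : ∀ s, 0 < s → HasDerivAt P (s ^ b / s * (b ^ 2 * W s +
      1 / 4 * ((s ^ (γ / 2)) ^ 3 / V s ^ 2 - (s ^ (γ / 2)) / c ^ 2))) s := fun s hs => by
    have h1 := (hbd s hs).mul ((((hasDerivAt_id s).mul (hw' s hs)).sub
      ((hpd s hs).const_mul (c * (γ / 2)))).add ((hWd s hs).const_mul b))
    refine h1.congr_deriv ?_
    have hVp : 0 < V s := by linarith [hV1 s hs.le]
    have ea : s ^ a = (s ^ (γ / 2)) ^ 3 / s := by
      rw [haγ, Real.rpow_sub_one hs.ne', mul_comm, Real.rpow_mul hs.le]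
      norm_cast
    have ec : 1 / c ^ 2 = c * (γ * (γ + 4 * b)) := by
      rw [show 4 * b = n - 2 by rw [hb]; ring, div_eq_iff (by positivity)]
      linear_combination -hcγ
    have en : n = 4 * b + 2 := by rw [hb]; ring
    rw [ea, div_eq_mul_one_div (s ^ (γ / 2)) (c ^ 2), ec, en]
    simp only [hW, id, Pi.mul_apply, Pi.sub_apply, Pi.add_apply]
    field_simp
    ring
  have hQd : ∀ s, 0 < s → HasDerivAt (fun s => s ^ b * W s) (P s / s) s := fun s hs => by
    refine ((hbd s hs).mul (hWd s hs)).congr_deriv ?_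
    simp only [hP]
    field_simp
    ring
  by_contra! hlt
  have hW0 : W 0 = 1 := by
    simp [hW, hV0, Real.zero_rpow (by positivity : γ / 2 ≠ 0)]
  -- `s₀` is the first point where the difference `W` stops being positive.
  obtain ⟨s₀, ⟨⟨hs00, hs0s⟩, hWs0⟩, hmin⟩ :=
    ((isCompact_Icc (a := (0 : ℝ)) (b := s)).inter_right
      (isClosed_le hWc continuous_const : IsClosed {t | W t ≤ 0})).exists_isLeast
      ⟨s, ⟨hs, le_rfl⟩, by simp only [Set.mem_ofPred_eq, hW]; linarith⟩
  have hs0 : 0 < s₀ := by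
    rcases hs00.eq_or_lt with h | h
    · rw [← h, Set.mem_ofPred_eq, hW0] at hWs0; linarith
    · exact h
  have hWpos : ∀ t, 0 ≤ t → t < s₀ → 0 < W t := fun t ht hts => by
    by_contra! h
    exact (hmin ⟨⟨ht, hts.le.trans hs0s⟩, h⟩).not_gt hts
  have hP0 : P 0 = 0 := by simp [hP, Real.zero_rpow hb0.ne']
  have hPm : MonotoneOn P (Set.Icc 0 s₀) := by
    refine monotoneOn_of_deriv_nonneg (convex_Icc _ _) hPc.continuousOn ?_ ?_
    · rw [interior_Icc]
      exact fun t ht => (hPd t ht.1).differentiableAt.differentiableWithinAt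
    · rw [interior_Icc]
      intro t ht
      rw [(hPd t ht.1).deriv]
      have hWt := hWpos t ht.1.le ht.2
      have hVt : 0 < V t := by linarith [hV1 t ht.1.le]
      have hp : 0 < t ^ (γ / 2) := Real.rpow_pos_of_pos ht.1 _
      have htb : 0 ≤ t ^ b / t := div_nonneg (Real.rpow_nonneg ht.1.le _) ht.1.le
      refine mul_nonneg htb ?_
      simp only [hW] at hWt ⊢
      set p := t ^ (γ / 2)
      set v := V t
      -- Convexity of `x ↦ x⁻²`: its graph lies above the tangent at the singular value `c p`. With
      -- `κ ≤ 2b²` this gives `P' ≥ 0` while `W > 0`.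
      have hconv : -2 * (γ * (γ + (n - 2))) * (v - c * p) ≤ p ^ 3 / v ^ 2 - p / c ^ 2 := by
        have h1 : γ * (γ + (n - 2)) = 1 / c ^ 3 := by
          rw [eq_div_iff (by positivity)]; linarith
        rw [h1]
        have h2 : p ^ 3 / v ^ 2 - p / c ^ 2 - -2 * (1 / c ^ 3) * (v - c * p) =
            (v - c * p) ^ 2 * (2 * v + c * p) / (v ^ 2 * c ^ 3) := by
          field_simp; ring
        have h3 : 0 ≤ (v - c * p) ^ 2 * (2 * v + c * p) / (v ^ 2 * c ^ 3) := by positivity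
        linarith
      nlinarith [mul_le_mul_of_nonneg_right hJL hWt.le]
  have hPnn : ∀ t, 0 ≤ t → t ≤ s₀ → 0 ≤ P t := fun t ht hts => by
    rw [← hP0]; exact hPm ⟨le_rfl, hs0.le⟩ ⟨ht, hts⟩ ht
  have hQm : MonotoneOn (fun s => s ^ b * W s) (Set.Icc 0 s₀) := by
    refine monotoneOn_of_deriv_nonneg (convex_Icc _ _) (by fun_prop) ?_ ?_
    · rw [interior_Icc]
      exact fun t ht => (hQd t ht.1).differentiableAt.differentiableWithinAt
    · rw [interior_Icc]
      intro t ht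
      rw [(hQd t ht.1).deriv]
      exact div_nonneg (hPnn t ht.1.le ht.2.le) ht.1.le
  -- `s^b W` is nondecreasing up to `s₀` but positive at `s₀/2`, so it cannot be nonpositive at
  -- `s₀`.
  have h1 := hQm ⟨by positivity, by linarith⟩ ⟨hs0.le, le_rfl⟩ (by linarith : s₀ / 2 ≤ s₀)
  simp only at h1
  have h2 : 0 < (s₀ / 2) ^ b * W (s₀ / 2) :=
    mul_pos (Real.rpow_pos_of_pos (by positivity) _) (hWpos _ (by positivity) (by linarith))
  have h3 : s₀ ^ b * W s₀ ≤ 0 := mul_nonpos_of_nonneg_of_nonpos (Real.rpow_nonneg hs0.le _) hWs0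
  linarith

/-! ### Hardy's inequality. -/

lemma divergence_id {N : ℕ} (x : EuclideanSpace ℝ (Fin N)) : divergence (fun x => x) x = N := by
  simp [divergence]

/-- Hardy's inequality with the regularized weight `(‖x‖² + ε)⁻¹`. -/
theorem regularized_hardy {N : ℕ} (hN : 2 ≤ N) {ε : ℝ} (hε : 0 < ε)
    {φ : EuclideanSpace ℝ (Fin N) → ℝ} (hφ : ContDiff ℝ 1 φ) (hs : HasCompactSupport φ) :
    0 ≤ ∫ x, (‖fderiv ℝ φ x‖ ^ 2 - (((N : ℝ) - 2) / 2) ^ 2 * (φ x ^ 2 / (‖x‖ ^ 2 + ε))) := by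
  have h2 : (2 : ℝ) ≤ N := by exact_mod_cast hN
  set β := ((N : ℝ) - 2) / 2 with hβ
  have hβ0 : 0 ≤ β := by rw [hβ]; linarith
  have hφc := hφ.continuous
  have hφ' := hφ.continuous_fderiv one_ne_zero
  have hDp : ∀ x : EuclideanSpace ℝ (Fin N), 0 < ‖x‖ ^ 2 + ε := fun x => by positivity
  have hDne : ∀ x : EuclideanSpace ℝ (Fin N), ‖x‖ ^ 2 + ε ≠ 0 := fun x => (hDp x).ne'
  have hsq : ContDiff ℝ 1 fun x : EuclideanSpace ℝ (Fin N) => ‖x‖ ^ 2 + ε :=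
    (contDiff_norm_sq ℝ).add contDiff_const
  have hs2 : HasCompactSupport fun x => φ x ^ 2 := hs.comp_left (g := fun t : ℝ => t ^ 2) (by simp)
  set η : EuclideanSpace ℝ (Fin N) → ℝ := fun x => φ x ^ 2 * (‖x‖ ^ 2 + ε)⁻¹ with hη
  have hη1 : ContDiff ℝ 1 η := (hφ.pow 2).mul (hsq.inv hDne)
  have h1 := integral_fderiv_add_mul_divergence hη1 hs2.mul_right contDiff_id
  have hd : ∀ x, fderiv ℝ η x (id x) + η x * divergence id x =
      2 * φ x * fderiv ℝ φ x x / (‖x‖ ^ 2 + ε) - 2 * φ x ^ 2 * ‖x‖ ^ 2 / (‖x‖ ^ 2 + ε) ^ 2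
        + N * φ x ^ 2 / (‖x‖ ^ 2 + ε) := fun x => by
    have h3 := ((hφ.differentiable one_ne_zero x).hasFDerivAt.pow 2).mul
      ((hasDerivAt_inv (hDne x)).comp_hasFDerivAt x
        ((hasStrictFDerivAt_norm_sq x).hasFDerivAt.add_const ε))
    have h4 : fderiv ℝ η x = _ := h3.fderiv
    have h5 : divergence id x = N := divergence_id x
    have := hDne x
    rw [h4, h5]
    simp only [_root_.add_apply, _root_.smul_apply, smul_eq_mul, hη, nsmul_eq_mul, Function.comp,
      id, innerSL_apply_apply, real_inner_self_eq_norm_sq]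
    field_simp
    push_cast
    ring
  simp only [hd] at h1
  have hsz : ∀ x, x ∉ tsupport φ → φ x = 0 ∧ fderiv ℝ φ x = 0 := fun x hx =>
    ⟨image_eq_zero_of_notMem_tsupport hx,
      image_eq_zero_of_notMem_tsupport fun h => hx (tsupport_fderiv_subset ℝ h)⟩
  have i1 : Integrable fun x => 2 * φ x * fderiv ℝ φ x x / (‖x‖ ^ 2 + ε)
      - 2 * φ x ^ 2 * ‖x‖ ^ 2 / (‖x‖ ^ 2 + ε) ^ 2 + N * φ x ^ 2 / (‖x‖ ^ 2 + ε) := by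
    refine Continuous.integrable_of_hasCompactSupport (by fun_prop (disch := simp [hDne]))
      (HasCompactSupport.intro hs fun x hx => ?_)
    simp [hsz x hx]
  have i2 : Integrable fun x =>
      ‖fderiv ℝ φ x‖ ^ 2 - β ^ 2 * (φ x ^ 2 / (‖x‖ ^ 2 + ε)) := by
    refine Continuous.integrable_of_hasCompactSupport (by fun_prop (disch := simp [hDne]))
      (HasCompactSupport.intro hs fun x hx => ?_)
    simp [hsz x hx]
  -- The inequality comes from expanding `|∇φ + β φ x/(‖x‖²+ε)|² ≥ 0`; `-β` times the null integral
  -- supplies its cross term.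
  have h6 : ∫ x, -β * (2 * φ x * fderiv ℝ φ x x / (‖x‖ ^ 2 + ε)
      - 2 * φ x ^ 2 * ‖x‖ ^ 2 / (‖x‖ ^ 2 + ε) ^ 2 + N * φ x ^ 2 / (‖x‖ ^ 2 + ε)) = 0 := by
    rw [integral_const_mul, h1, mul_zero]
  rw [← h6]
  refine integral_mono (i1.const_mul _) i2 fun x => ?_
  have hD := hDp x
  set D := ‖x‖ ^ 2 + ε with hDdef
  have hcs : |fderiv ℝ φ x x| ≤ ‖fderiv ℝ φ x‖ * ‖x‖ := by
    have := (fderiv ℝ φ x).le_opNorm x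
    rwa [Real.norm_eq_abs] at this
  set p := ‖fderiv ℝ φ x‖
  have hcross : -(2 * β * φ x * fderiv ℝ φ x x / D) ≤ p ^ 2 + β ^ 2 * φ x ^ 2 * ‖x‖ ^ 2 / D ^ 2 := by
    have e1 : -(2 * β * φ x * fderiv ℝ φ x x / D) ≤ 2 * (p * (β * |φ x| * ‖x‖ / D)) := by
      refine (neg_le_abs _).trans ?_
      rw [abs_div, abs_mul, abs_mul, abs_mul, abs_two, abs_of_nonneg hβ0, abs_of_pos hD]
      calc _ ≤ 2 * β * |φ x| * (p * ‖x‖) / D := by gcongr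
        _ = _ := by ring
    have e2 : (β * |φ x| * ‖x‖ / D) ^ 2 = β ^ 2 * φ x ^ 2 * ‖x‖ ^ 2 / D ^ 2 := by
      rw [div_pow, mul_pow, mul_pow, sq_abs]
    rw [← e2]
    nlinarith [sq_nonneg (p - β * |φ x| * ‖x‖ / D)]
  -- With `N = 2β + 2` the difference of the two sides is `β(N-β)ε φ²/(‖x‖²+ε)²`, a nonnegative
  -- error due to the regularization.
  have hmain : -(β * (N * φ x ^ 2 / D)) + β * (2 * φ x ^ 2 * ‖x‖ ^ 2 / D ^ 2)
      + β ^ 2 * φ x ^ 2 * ‖x‖ ^ 2 / D ^ 2 ≤ -(β ^ 2 * (φ x ^ 2 / D)) := by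
    have e3 : -(β ^ 2 * (φ x ^ 2 / D)) - (-(β * (N * φ x ^ 2 / D))
        + β * (2 * φ x ^ 2 * ‖x‖ ^ 2 / D ^ 2) + β ^ 2 * φ x ^ 2 * ‖x‖ ^ 2 / D ^ 2) =
        β * φ x ^ 2 * (N - β) * ε / D ^ 2 := by
      have e4 : (N : ℝ) = 2 * β + 2 := by rw [hβ]; ring
      have e5 : ‖x‖ ^ 2 = D - ε := by rw [hDdef]; ring
      rw [e4, e5]
      field_simp
      ring
    have e6 : 0 ≤ (N : ℝ) - β := by rw [hβ]; linarith
    have e7 : 0 ≤ β * φ x ^ 2 * (N - β) * ε / D ^ 2 := by positivity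
    linarith
  have e8 : -β * (2 * φ x * fderiv ℝ φ x x / D - 2 * φ x ^ 2 * ‖x‖ ^ 2 / D ^ 2 + N * φ x ^ 2 / D) =
      -(2 * β * φ x * fderiv ℝ φ x x / D) + (-(β * (N * φ x ^ 2 / D))
        + β * (2 * φ x ^ 2 * ‖x‖ ^ 2 / D ^ 2)) := by ring
  rw [e8]
  linarith

/-- Hardy's inequality: a potential dominated by `((N-2)/2)² / ‖x‖²` has a nonnegative form. -/
theorem form_nonneg_of_le_hardy {N : ℕ} (hN : 2 ≤ N) {p : EuclideanSpace ℝ (Fin N) → ℝ}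
    (hp : Continuous p) (hle : ∀ x, p x * ‖x‖ ^ 2 ≤ (((N : ℝ) - 2) / 2) ^ 2)
    {φ : EuclideanSpace ℝ (Fin N) → ℝ} (hφ : ContDiff ℝ 1 φ) (hs : HasCompactSupport φ) :
    0 ≤ ∫ x, (‖fderiv ℝ φ x‖ ^ 2 - p x * φ x ^ 2) := by
  have hφc := hφ.continuous
  have hφ' := hφ.continuous_fderiv one_ne_zero
  have hsz : ∀ x, x ∉ tsupport φ → φ x = 0 ∧ fderiv ℝ φ x = 0 := fun x hx =>
    ⟨image_eq_zero_of_notMem_tsupport hx,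
      image_eq_zero_of_notMem_tsupport fun h => hx (tsupport_fderiv_subset ℝ h)⟩
  set e : ℕ → ℝ := fun n => 1 / ((n : ℝ) + 1) with he
  have hep : ∀ n, 0 < e n := fun n => by rw [he]; positivity
  have he0 : Filter.Tendsto e Filter.atTop (nhds 0) := tendsto_one_div_add_atTop_nhds_zero_nat
  have hDne : ∀ n (x : EuclideanSpace ℝ (Fin N)), ‖x‖ ^ 2 + e n ≠ 0 := fun n x => by
    have := hep n; positivity
  have hc : ∀ n, Continuous fun x =>
      ‖fderiv ℝ φ x‖ ^ 2 - p x * φ x ^ 2 * (‖x‖ ^ 2 / (‖x‖ ^ 2 + e n)) := fun n => by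
    fun_prop (disch := simp [hDne])
  -- Damping `p` by `‖x‖²/(‖x‖²+ε)` places it below the regularized Hardy weight; as `ε → 0` the
  -- factor tends to `1` off the origin, a null set.
  have hlim : Filter.Tendsto (fun n => ∫ x,
      (‖fderiv ℝ φ x‖ ^ 2 - p x * φ x ^ 2 * (‖x‖ ^ 2 / (‖x‖ ^ 2 + e n))))
      Filter.atTop (nhds (∫ x, (‖fderiv ℝ φ x‖ ^ 2 - p x * φ x ^ 2))) := by
    refine tendsto_integral_of_dominated_convergence
      (fun x => ‖fderiv ℝ φ x‖ ^ 2 + |p x| * φ x ^ 2) (fun n => (hc n).aestronglyMeasurable) ?_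
      (fun n => Filter.Eventually.of_forall fun x => ?_) ?_
    · refine Continuous.integrable_of_hasCompactSupport (by fun_prop)
        (HasCompactSupport.intro hs fun x hx => ?_)
      simp [hsz x hx]
    · refine (norm_sub_le _ _).trans ?_
      have h1 : ‖x‖ ^ 2 / (‖x‖ ^ 2 + e n) ≤ 1 := by
        have := hep n
        rw [div_le_one (by positivity)]; linarith
      have h0 : 0 ≤ ‖x‖ ^ 2 / (‖x‖ ^ 2 + e n) := by have := hep n; positivity
      rw [norm_mul, norm_mul, Real.norm_of_nonneg h0, Real.norm_of_nonneg (sq_nonneg (φ x)),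
        Real.norm_of_nonneg (sq_nonneg ‖fderiv ℝ φ x‖), Real.norm_eq_abs]
      exact add_le_add_right (mul_le_of_le_one_right (by positivity) h1) _
    · have : Nonempty (Fin N) := ⟨⟨0, by omega⟩⟩
      have hne : ∀ᵐ x : EuclideanSpace ℝ (Fin N), x ≠ 0 := by
        simp [ae_iff]
      filter_upwards [hne] with x hx
      have h0 : ‖x‖ ^ 2 ≠ 0 := pow_ne_zero 2 (norm_ne_zero_iff.2 hx)
      have h1 : Filter.Tendsto (fun n => ‖x‖ ^ 2 / (‖x‖ ^ 2 + e n)) Filter.atTop (nhds 1) := by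
        have := (tendsto_const_nhds (x := ‖x‖ ^ 2)).div ((tendsto_const_nhds (x := ‖x‖ ^ 2)).add he0)
          (by simpa using h0)
        rwa [add_zero, div_self h0] at this
      simpa using (h1.const_mul (p x * φ x ^ 2)).const_sub (‖fderiv ℝ φ x‖ ^ 2)
  refine ge_of_tendsto' hlim fun n => (regularized_hardy hN (hep n) hφ hs).trans
    (integral_mono ?_ ?_ fun x => ?_)
  · refine Continuous.integrable_of_hasCompactSupport (by fun_prop (disch := simp [hDne]))
      (HasCompactSupport.intro hs fun x hx => ?_)
    simp [hsz x hx]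
  · refine Continuous.integrable_of_hasCompactSupport (hc n)
      (HasCompactSupport.intro hs fun x hx => ?_)
    simp [hsz x hx]
  · have h1 := mul_le_mul_of_nonneg_right (hle x)
      (by have := hep n; positivity : 0 ≤ φ x ^ 2 / (‖x‖ ^ 2 + e n))
    have h2 : p x * φ x ^ 2 * (‖x‖ ^ 2 / (‖x‖ ^ 2 + e n)) =
      p x * ‖x‖ ^ 2 * (φ x ^ 2 / (‖x‖ ^ 2 + e n)) := by ring
    simp only
    rw [h2]
    linarith

/-! ### The critical exponent and the semistable solution. -/

/-- With `M = N - 2` and `γ = (2+α)/3`, the claim is `(4γ+2M)² ≤ 6M²`, i.e. `4γ ≤ (√6-2)M`. Since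
`(√6-2)(4+2√6) = 4`, this is `γ(4+2√6) ≤ M`, a rewriting of `α ≤ α_N`. -/
lemma josephLundgren_of_le_alphaCrit {N : ℕ} {α : ℝ} (hN : 8 ≤ N) (hα : 0 ≤ α)
    (hc : α ≤ alphaCrit N) :
    (2 + α) / 3 * ((2 + α) / 3 + ((N : ℝ) - 2)) ≤ 2 * (((N : ℝ) - 2) / 4) ^ 2 := by
  have h8 : (8 : ℝ) ≤ N := by exact_mod_cast hN
  have h6 : 0 < Real.sqrt 6 := by positivity
  have h66 : Real.sqrt 6 ^ 2 = 6 := Real.sq_sqrt (by norm_num)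
  rw [alphaCrit, le_div_iff₀ (by positivity)] at hc
  set γ := (2 + α) / 3 with hγ
  have hγ0 : 0 < γ := by positivity
  have hα' : α = 3 * γ - 2 := by rw [hγ]; ring
  set M := (N : ℝ) - 2 with hM
  have hM0 : 0 < M := by linarith
  have h1 : γ * (4 + 2 * Real.sqrt 6) ≤ M := by
    rw [hα'] at hc
    linarith
  have h2 : 4 * γ ≤ (Real.sqrt 6 - 2) * M := by
    have h3 : 2 < Real.sqrt 6 := by
      rw [Real.lt_sqrt (by norm_num)]; norm_num
    nlinarith [mul_le_mul_of_nonneg_left h1 (sub_nonneg.2 h3.le)]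
  have h4 : 4 * γ + 2 * M ≤ Real.sqrt 6 * M := by linarith
  have h5 : (4 * γ + 2 * M) ^ 2 ≤ 6 * M ^ 2 := by
    calc _ ≤ (Real.sqrt 6 * M) ^ 2 := by gcongr
      _ = _ := by rw [mul_pow, h66]
  nlinarith

/-- For `0 ≤ α ≤ α_N` the regular radial solution is semistable. -/
theorem exists_semistable_solution {N : ℕ} {α : ℝ} (hN : 8 ≤ N) (hα : 0 ≤ α)
    (hc : α ≤ alphaCrit N) :
    ∃ U : EuclideanSpace ℝ (Fin N) → ℝ, IsEntireSolution N α U ∧ 0 ≤ mu1 N α U := by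
  have h8 : (8 : ℝ) ≤ N := by exact_mod_cast hN
  have hJL := josephLundgren_of_le_alphaCrit hN hα hc
  obtain ⟨V, w, hw, hV, hV0, hV1, hw0, hw'⟩ :=
    exists_radial_solution (N := N) (by omega) (a := α / 2) (by positivity)
  have hVc : Continuous V := continuous_iff_continuousAt.2 fun s => (hV s).continuousAt
  -- extend `s w'(s)` to a continuous function on the line
  set h : ℝ → ℝ := fun s => |s| ^ (α / 2) / V |s| ^ 2 / 4 - N / 2 * w s with hh
  have hVne : ∀ s, V |s| ≠ 0 := fun s => by linarith [hV1 |s| (abs_nonneg s)]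
  have hac : Continuous fun t : ℝ => |t| ^ (α / 2) :=
    continuous_abs.rpow_const fun _ => Or.inr (by positivity)
  have hhc : Continuous h := by fun_prop (disch := simp [hVne])
  -- The value `w 0 = 0^(α/2)/(2N)` cancels the source term in both cases: `0^0 = 1` when `α = 0`,
  -- and `0` when `α > 0`.
  have hh0 : h 0 = 0 := by
    simp only [hh, abs_zero, hV0, hw0]; field_simp; ring
  obtain ⟨hU2, hΔ⟩ := contDiff_two_radial (N := N) hw hhc hh0 hV fun s hs => by
    simpa only [hh, abs_of_pos hs] using hw' s hs
  set U : EuclideanSpace ℝ (Fin N) → ℝ := fun y => V (‖y‖ ^ 2) with hU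
  have hU1 : ∀ y, 1 ≤ U y := fun y => hV1 _ (sq_nonneg _)
  have hpow : ∀ y : EuclideanSpace ℝ (Fin N), ∀ t : ℝ, (‖y‖ ^ 2) ^ (t / 2) = ‖y‖ ^ t := fun y t => by
    rw [← Real.rpow_natCast, ← Real.rpow_mul (norm_nonneg y)]
    congr 1; push_cast; ring
  have hsol : IsEntireSolution N α U := by
    refine ⟨hU2, fun y => ?_, 1, one_pos, hU1⟩
    rw [hΔ]
    simp only [hh, abs_of_nonneg (sq_nonneg ‖y‖), hpow]
    ring
  refine ⟨U, hsol, le_sInf ?_⟩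
  rintro _ ⟨φ, hφ, rfl⟩
  suffices 0 ≤ stabilityForm N α U φ by exact_mod_cast this
  rw [stabilityForm]
  simp only [norm_gradient]
  have hUc := hU2.continuous
  have hρ := continuous_norm_rpow (N := N) hα
  have hUne : ∀ y, U y ≠ 0 := fun y => (hsol.pos y).ne'
  refine form_nonneg_of_le_hardy (p := fun y => 2 * ‖y‖ ^ α / U y ^ 3) (by omega)
    (by fun_prop (disch := simp [hUne])) (fun y => ?_) (hφ.contDiff.of_le (by simp))
    hφ.compactSupport
  set γ := (2 + α) / 3 with hγ
  have hγ0 : 0 < γ := by positivity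
  set κ := γ * (γ + ((N : ℝ) - 2)) with hκ
  have hκ0 : 0 < κ := by
    have : 0 < (N : ℝ) - 2 := by linarith
    positivity
  set c := κ⁻¹ ^ (1 / 3 : ℝ) with hcdef
  have hc0 : 0 < c := by positivity
  have hc3 : c ^ 3 * κ = 1 := by
    rw [hcdef, ← Real.rpow_natCast, ← Real.rpow_mul (by positivity)]
    norm_num
    exact inv_mul_cancel₀ hκ0.ne'
  have hle := singular_le_radial (n := N) (by linarith) hγ0 (a := α / 2) (by rw [hγ]; ring) hc0 hc3
    hJL hw hV hV0 hV1 hw' (sq_nonneg ‖y‖)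
  rw [hpow] at hle
  have hcube : c ^ 3 * (‖y‖ ^ α * ‖y‖ ^ 2) ≤ U y ^ 3 := by
    calc _ = (c * ‖y‖ ^ γ) ^ 3 := by
          rw [mul_pow, ← Real.rpow_natCast (‖y‖ ^ γ), ← Real.rpow_mul (norm_nonneg y),
            ← Real.rpow_natCast ‖y‖ 2, ← Real.rpow_add_of_nonneg (norm_nonneg y) hα (by simp)]
          congr 2; rw [hγ]; push_cast; ring
      _ ≤ _ := by gcongr
  have hU3 : 0 < U y ^ 3 := by have := hsol.pos y; positivity
  have h1 : 2 * ‖y‖ ^ α / U y ^ 3 * ‖y‖ ^ 2 ≤ 2 * κ := by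
    rw [div_mul_eq_mul_div, div_le_iff₀ hU3]
    calc 2 * ‖y‖ ^ α * ‖y‖ ^ 2 = 2 * κ * (c ^ 3 * (‖y‖ ^ α * ‖y‖ ^ 2)) := by
          linear_combination (-2 * (‖y‖ ^ α * ‖y‖ ^ 2)) * hc3
      _ ≤ _ := by gcongr
  calc _ ≤ 2 * κ := h1
    _ ≤ 2 * (2 * (((N : ℝ) - 2) / 4) ^ 2) := by gcongr
    _ = _ := by ring

theorem theorem1p4 (N : ℕ) (α : ℝ) :
    (((1 ≤ N ∧ N ≤ 7 ∧ 0 ≤ α) ∨ (8 ≤ N ∧ alphaCrit N < α)) →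
      ∀ U : EuclideanSpace ℝ (Fin N) → ℝ, IsEntireSolution N α U → mu1 N α U < 0) ∧
    ((8 ≤ N ∧ 0 ≤ α ∧ α ≤ alphaCrit N) →
      ∃ U : EuclideanSpace ℝ (Fin N) → ℝ, IsEntireSolution N α U ∧ 0 ≤ mu1 N α U) := by
  refine ⟨?_, fun ⟨hN, hα, hc⟩ => exists_semistable_solution hN hα hc⟩
  have h66 : Real.sqrt 6 ^ 2 = 6 := Real.sq_sqrt (by norm_num)
  have h6 : 0 < Real.sqrt 6 := by positivity
  rintro (⟨hN1, hN7, hα⟩ | ⟨hN, hc⟩) U hU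
  · refine hU.mu1_neg hN1 hα (lt_of_lt_of_le ?_ hα)
    have h7 : (N : ℝ) ≤ 7 := by exact_mod_cast hN7
    -- For `N ≤ 7` the numerator is at most `7 - 4√6 < 0`, so every `α ≥ 0` exceeds `α_N`.
    refine div_neg_of_neg_of_pos ?_ (by positivity)
    nlinarith
  · refine hU.mu1_neg (by omega) (le_trans ?_ hc.le) hc
    have h8 : (8 : ℝ) ≤ N := by exact_mod_cast hN
    -- For `N ≥ 8` it is at least `10 - 4√6 > 0`, so `α > α_N` forces `α ≥ 0`.
    refine div_nonneg ?_ (by positivity)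
    nlinarith
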